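/- Let $V$ be a complex vector space with basis $v_1,\dots,v_n$, and let $\mathbf q=(q_{ij})_{1\le i,j\le n}$ be nonzero complex numbers with $q_{ii}=1$ and $q_{ji}=q_{ij}^{-1}$ for all $i,j$. Let $S_{\mathbf q}(V)=\mathbb C\langle v_1,\dots,v_n\mid v_iv_j=q_{ij}v_jv_i\rangle$ and $\Lambda_{\mathbf q}(V)=\mathbb C\langle v_1,\dots,v_n\mid v_iv_j=-q_{ij}v_jv_i\rangle$ (relations for all $i,j$) be the quantum symmetric and quantum exterior algebras. Let $G$ be a finite group acting linearly on $V$, and let $\alpha:G\times G\to\mathbb C^\times$ be a normalized 2-cocycle. For an algebra $A$ on which $G$ acts by algebra automorphisms, the twisted skew group algebra $A\#_\alpha G$ is the vector space $A\otimes\mathbb C G$, with $a\otimes g$ written $at_g$ and multiplication $(at_g)(bt_h)=\alpha(g,h)\,a\,({}^g b)\,t_{gh}$; in particular $\mathbb C^\alpha G=\mathbb C\#_\alpha G$ (with trivial action on $\mathbb C$) is a subalgebra of it when $A\ne 0$. For a bilinear map $\kappa:V\times V\to\mathbb C^\alpha G$ put $$\mathcal H_{\mathbf q,\kappa,\alpha}=T(V)\#_\alpha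 G\,/\,(v_iv_j-q_{ij}v_jv_i-\kappa(v_i,v_j)\mid 1\le i,j\le n),$$ filtered by giving each $v_i$ degree one and each $t_g$ degree zero. Suppose that the action of $G$ on $V$ extends to an action by algebra automorphisms on $S_{\mathbf q}(V)$ and on $\Lambda_{\mathbf q}(V)$, and grade $S_{\mathbf q}(V)\#_\alpha G$ by giving each $v_i$ degree one and each $t_g$ degree zero. Call $\mathcal H_{\mathbf q,\kappa,\alpha}$ a twisted quantum Drinfeld Hecke algebra if $\kappa(v_i,v_j)=-q_{ij}\kappa(v_j,v_i)$ for all $i,j$ and the associated graded algebra of $\mathcal H_{\mathbf q,\kappa,\alpha}$ is isomorphic, as a graded algebra, to $S_{\mathbf q}(V)\#_\alpha G$. Let $\mu_1$ be a constant Hochschild 2-cocycle on $A=S_{\mathbf q}(V)\#_\alpha G$, that is, a bilinear map $\mu_1:A\times A\to A$ with $a\mu_1(b,c)+\mu_1(a,bc)=\mu_1(ab,c)+\mu_1(a,b)c$ for all $a,b,c\in A$ which is homogeneous of degree $-2$. Then there is exactly one bilinear map $\kappa:V\times V\to\mathbb C^\alpha G$ with $$\kappa(v_i,v_j)=\mu_1(v_i,v_j)-q_{ij}\,\mu_1(v_j,v_i)\qquad\text{for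 all } i,j$$ (the quantum skew-symmetrization of $\mu_1$), and for this $\kappa$ the algebra $\mathcal H_{\mathbf q,\kappa,\alpha}$ is a twisted quantum Drinfeld Hecke algebra. -/

import Mathlib

noncomputable section

open scoped DirectSum

namespace QDHA

/-! ### Twisted skew group algebras -/

/-- A normalized `2`-cocycle `α : G × G → ℂˣ` on a group `G`. -/
structure NormalizedTwoCocycle (G : Type*) [Group G] where
  toFun : G → G → ℂˣ
  cocycle : ∀ g₁ g₂ g₃ : G,
    toFun g₁ g₂ * toFun (g₁ * g₂) g₃ = toFun g₂ g₃ * toFun g₁ (g₂ * g₃)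
  map_one_right : ∀ g : G, toFun g 1 = 1
  map_one_left : ∀ g : G, toFun 1 g = 1

instance {G : Type*} [Group G] :
    CoeFun (NormalizedTwoCocycle G) (fun _ => G → G → ℂˣ) :=
  ⟨NormalizedTwoCocycle.toFun⟩

/-- The twisted skew group algebra `A #_α G`, for an action `φ` of `G` on `A` by algebra
automorphisms. The element `∑ a_g t_g` is the finitely supported function `g ↦ a_g`. -/
def TwistedSkewGroupAlgebra {G A : Type*} [Group G] [Ring A] [Algebra ℂ A]
    (_φ : G →* (A ≃ₐ[ℂ] A)) (_α : NormalizedTwoCocycle G) : Type _ :=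
  G →₀ A

namespace TwistedSkewGroupAlgebra

variable {G A : Type*} [Group G] [Ring A] [Algebra ℂ A]
  (φ : G →* (A ≃ₐ[ℂ] A)) (α : NormalizedTwoCocycle G)

instance : AddCommGroup (TwistedSkewGroupAlgebra φ α) :=
  inferInstanceAs (AddCommGroup (G →₀ A))

instance : Module ℂ (TwistedSkewGroupAlgebra φ α) :=
  inferInstanceAs (Module ℂ (G →₀ A))

/-- The family of coefficients of an element of `A #_α G`. -/
def toFinsupp : TwistedSkewGroupAlgebra φ α ≃ₗ[ℂ] (G →₀ A) :=
  LinearEquiv.refl ℂ (G →₀ A)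

/-- The element `a t_g` of `A #_α G`, as a linear function of `a`. -/
def single (g : G) : A →ₗ[ℂ] TwistedSkewGroupAlgebra φ α :=
  (toFinsupp φ α).symm.toLinearMap ∘ₗ Finsupp.lsingle g

/-- The coefficient of `t_g`, as a linear map. -/
def coeff (g : G) : TwistedSkewGroupAlgebra φ α →ₗ[ℂ] A :=
  Finsupp.lapply g ∘ₗ (toFinsupp φ α).toLinearMap

/-- `(a t_g) (b t_h) = α(g,h) a (ᵍb) t_{gh}`, extended biadditively. -/
instance : Mul (TwistedSkewGroupAlgebra φ α) where
  mul x y := (toFinsupp φ α x).sum fun g a => (toFinsupp φ α y).sum fun h b =>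
    single φ α (g * h) ((α g h : ℂ) • (a * φ g b))

instance : One (TwistedSkewGroupAlgebra φ α) where
  one := single φ α 1 1

variable {φ α}

theorem mul_def (x y : TwistedSkewGroupAlgebra φ α) :
    x * y = (toFinsupp φ α x).sum fun g a => (toFinsupp φ α y).sum fun h b =>
      single φ α (g * h) ((α g h : ℂ) • (a * φ g b)) := rfl

theorem one_def : (1 : TwistedSkewGroupAlgebra φ α) = single φ α 1 1 := rfl

theorem toFinsupp_single (g : G) (a : A) :
    toFinsupp φ α (single φ α g a) = Finsupp.single g a := rfl

theorem single_mul_single (g h : G) (a b : A) :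
    single φ α g a * single φ α h b = single φ α (g * h) ((α g h : ℂ) • (a * φ g b)) := by
  rw [mul_def, toFinsupp_single, toFinsupp_single, Finsupp.sum_single_index,
    Finsupp.sum_single_index]
  · simp
  · simp

@[elab_as_elim]
theorem induction_linear {p : TwistedSkewGroupAlgebra φ α → Prop}
    (x : TwistedSkewGroupAlgebra φ α) (zero : p 0) (add : ∀ x y, p x → p y → p (x + y))
    (single : ∀ g a, p (single φ α g a)) : p x :=
  Finsupp.induction_linear (motive := p) x zero add single

theorem mul_add' (x y z : TwistedSkewGroupAlgebra φ α) : x * (y + z) = x * y + x * z := by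
  simp only [mul_def, map_add (toFinsupp φ α)]
  rw [← Finsupp.sum_add]
  refine Finsupp.sum_congr fun g _ => ?_
  exact Finsupp.sum_add_index' (by simp) (by intros; simp [mul_add])

theorem add_mul' (x y z : TwistedSkewGroupAlgebra φ α) : (x + y) * z = x * z + y * z := by
  simp only [mul_def, map_add (toFinsupp φ α)]
  refine Finsupp.sum_add_index' (by simp) ?_
  intro g a b
  rw [← Finsupp.sum_add]
  exact Finsupp.sum_congr fun h _ => by simp [add_mul]

theorem mul_zero' (x : TwistedSkewGroupAlgebra φ α) : x * 0 = 0 := by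
  have h := mul_add' x 0 0
  simpa using h

theorem zero_mul' (x : TwistedSkewGroupAlgebra φ α) : 0 * x = 0 := by
  have h := add_mul' 0 0 x
  simpa using h

theorem mul_assoc' (x y z : TwistedSkewGroupAlgebra φ α) : x * y * z = x * (y * z) := by
  induction x using induction_linear with
  | zero => simp only [zero_mul']
  | add x₁ x₂ h₁ h₂ => simp only [add_mul', h₁, h₂]
  | single g a =>
    induction y using induction_linear with
    | zero => simp only [zero_mul', mul_zero']
    | add y₁ y₂ h₁ h₂ => simp only [add_mul', mul_add', h₁, h₂]
    | single h b =>
      induction z using induction_linear with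
      | zero => simp only [mul_zero']
      | add z₁ z₂ h₁ h₂ => simp only [mul_add', h₁, h₂]
      | single k c =>
        have hα : (α g h : ℂ) * (α (g * h) k : ℂ) = (α h k : ℂ) * (α g (h * k) : ℂ) := by
          exact_mod_cast congrArg Units.val (α.cocycle g h k)
        rw [single_mul_single, single_mul_single, single_mul_single, single_mul_single]
        simp only [map_mul, AlgEquiv.mul_apply, smul_mul_assoc, mul_smul_comm, smul_smul,
          mul_assoc, map_smul (φ g)]
        rw [mul_comm (α (g * h) k : ℂ), hα, mul_comm (α h k : ℂ)]

theorem one_mul' (x : TwistedSkewGroupAlgebra φ α) : 1 * x = x := by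
  induction x using induction_linear with
  | zero => rw [mul_zero']
  | add x₁ x₂ h₁ h₂ => rw [mul_add', h₁, h₂]
  | single g a => rw [one_def, single_mul_single, α.map_one_left]; simp

theorem mul_one' (x : TwistedSkewGroupAlgebra φ α) : x * 1 = x := by
  induction x using induction_linear with
  | zero => rw [zero_mul']
  | add x₁ x₂ h₁ h₂ => rw [add_mul', h₁, h₂]
  | single g a => rw [one_def, single_mul_single, α.map_one_right]; simp

instance : Ring (TwistedSkewGroupAlgebra φ α) :=
  { (inferInstance : AddCommGroup (TwistedSkewGroupAlgebra φ α)),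
    (inferInstance : Mul (TwistedSkewGroupAlgebra φ α)),
    (inferInstance : One (TwistedSkewGroupAlgebra φ α)) with
    left_distrib := mul_add'
    right_distrib := add_mul'
    zero_mul := zero_mul'
    mul_zero := mul_zero'
    mul_assoc := mul_assoc'
    one_mul := one_mul'
    mul_one := mul_one' }

theorem smul_mul' (r : ℂ) (x y : TwistedSkewGroupAlgebra φ α) : (r • x) * y = r • (x * y) := by
  induction x using induction_linear with
  | zero => simp
  | add x₁ x₂ h₁ h₂ => rw [smul_add, add_mul, h₁, h₂, add_mul, smul_add]
  | single g a =>
    induction y using induction_linear with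
    | zero => simp
    | add y₁ y₂ h₁ h₂ => rw [mul_add, h₁, h₂, mul_add, smul_add]
    | single h b =>
      rw [← map_smul, single_mul_single, single_mul_single, ← map_smul, smul_mul_assoc,
        smul_comm]

theorem mul_smul' (r : ℂ) (x y : TwistedSkewGroupAlgebra φ α) : x * (r • y) = r • (x * y) := by
  induction x using induction_linear with
  | zero => simp
  | add x₁ x₂ h₁ h₂ => rw [add_mul, h₁, h₂, add_mul, smul_add]
  | single g a =>
    induction y using induction_linear with
    | zero => simp
    | add y₁ y₂ h₁ h₂ => rw [smul_add, mul_add, h₁, h₂, mul_add, smul_add]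
    | single h b =>
      rw [← map_smul, single_mul_single, single_mul_single, ← map_smul, map_smul (φ g),
        mul_smul_comm, smul_comm]

instance : Algebra ℂ (TwistedSkewGroupAlgebra φ α) :=
  Algebra.ofModule smul_mul' mul_smul'

variable (φ α)

/-- For a subspace `W` of `A`, the subspace `W ⊗ ℂG` of `A #_α G`. -/
def coeffsIn (W : Submodule ℂ A) : Submodule ℂ (TwistedSkewGroupAlgebra φ α) :=
  ⨅ g : G, W.comap (coeff φ α g)

variable {φ α}

theorem mem_coeffsIn {W : Submodule ℂ A} {x : TwistedSkewGroupAlgebra φ α} :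
    x ∈ coeffsIn φ α W ↔ ∀ g : G, coeff φ α g x ∈ W := by
  simp [coeffsIn]

theorem single_mem_coeffsIn {W : Submodule ℂ A} (g : G) {a : A} (ha : a ∈ W) :
    single φ α g a ∈ coeffsIn φ α W := by
  classical
  refine mem_coeffsIn.2 fun h => ?_
  change (Finsupp.single g a) h ∈ W
  rw [Finsupp.single_apply]
  split_ifs
  · exact ha
  · exact W.zero_mem

theorem mul_mem_coeffsIn {W₁ W₂ W₃ : Submodule ℂ A}
    (hW : ∀ (g : G) (a b : A), a ∈ W₁ → b ∈ W₂ → a * φ g b ∈ W₃)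
    {x y : TwistedSkewGroupAlgebra φ α} (hx : x ∈ coeffsIn φ α W₁) (hy : y ∈ coeffsIn φ α W₂) :
    x * y ∈ coeffsIn φ α W₃ := by
  rw [mul_def]
  refine Submodule.sum_mem _ fun g _ => Submodule.sum_mem _ fun h _ => ?_
  exact single_mem_coeffsIn _
    (W₃.smul_mem _ (hW g _ _ (mem_coeffsIn.1 hx g) (mem_coeffsIn.1 hy h)))

end TwistedSkewGroupAlgebra

/-- The twisted group algebra `ℂ^α G`. -/
abbrev TwistedGroupAlgebra {G : Type*} [Group G] (α : NormalizedTwoCocycle G) : Type _ :=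
  TwistedSkewGroupAlgebra (1 : G →* (ℂ ≃ₐ[ℂ] ℂ)) α

/-- The inclusion `ℂ^α G → A #_α G`, `c t_g ↦ (c · 1) t_g`. -/
def groupInclusion {G A : Type*} [Group G] [Ring A] [Algebra ℂ A]
    (φ : G →* (A ≃ₐ[ℂ] A)) (α : NormalizedTwoCocycle G) :
    TwistedGroupAlgebra α →ₗ[ℂ] TwistedSkewGroupAlgebra φ α :=
  (TwistedSkewGroupAlgebra.toFinsupp φ α).symm.toLinearMap ∘ₗ
    Finsupp.mapRange.linearMap (Algebra.linearMap ℂ A) ∘ₗ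
      (TwistedSkewGroupAlgebra.toFinsupp 1 α).toLinearMap

/-! ### The tensor algebra, quantum symmetric algebra and quantum exterior algebra -/

/-- A tuple `q = (q_{ij})` of nonzero scalars with `q_{ii} = 1` and `q_{ji} = q_{ij}⁻¹`. -/
structure IsQuantumParameter {n : ℕ} (q : Fin n → Fin n → ℂ) : Prop where
  ne_zero : ∀ i j, q i j ≠ 0
  diag : ∀ i, q i i = 1
  inv : ∀ i j, q j i = (q i j)⁻¹

section Quadratic

variable {n : ℕ} {V : Type*} [AddCommGroup V] [Module ℂ V]

/-- The relations `v_i v_j = c_{ij} v_j v_i` in the tensor algebra. -/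
inductive CommutationRel (b : Module.Basis (Fin n) ℂ V) (c : Fin n → Fin n → ℂ) :
    TensorAlgebra ℂ V → TensorAlgebra ℂ V → Prop
  | mk (i j : Fin n) : CommutationRel b c
      (TensorAlgebra.ι ℂ (b i) * TensorAlgebra.ι ℂ (b j))
      (c i j • (TensorAlgebra.ι ℂ (b j) * TensorAlgebra.ι ℂ (b i)))

/-- The algebra `ℂ⟨v_1, …, v_n | v_i v_j = c_{ij} v_j v_i for all i, j⟩`. -/
def CommutationAlgebra (b : Module.Basis (Fin n) ℂ V) (c : Fin n → Fin n → ℂ) : Type _ :=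
  RingQuot (CommutationRel b c)

instance (b : Module.Basis (Fin n) ℂ V) (c : Fin n → Fin n → ℂ) :
    Ring (CommutationAlgebra b c) :=
  inferInstanceAs (Ring (RingQuot (CommutationRel b c)))

instance (b : Module.Basis (Fin n) ℂ V) (c : Fin n → Fin n → ℂ) :
    Algebra ℂ (CommutationAlgebra b c) :=
  inferInstanceAs (Algebra ℂ (RingQuot (CommutationRel b c)))

/-- The canonical map from `V` to `ℂ⟨v_1, …, v_n | v_i v_j = c_{ij} v_j v_i⟩`. -/
def CommutationAlgebra.ι (b : Module.Basis (Fin n) ℂ V) (c : Fin n → Fin n → ℂ) :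
    V →ₗ[ℂ] CommutationAlgebra b c :=
  (RingQuot.mkAlgHom ℂ (CommutationRel b c)).toLinearMap ∘ₗ TensorAlgebra.ι ℂ

/-- The homogeneous component of degree `m`: the span of the products of `m` vectors. -/
def CommutationAlgebra.piece (b : Module.Basis (Fin n) ℂ V) (c : Fin n → Fin n → ℂ) (m : ℕ) :
    Submodule ℂ (CommutationAlgebra b c) :=
  LinearMap.range (CommutationAlgebra.ι b c) ^ m

/-- The quantum symmetric algebra `S_q(V)`: `v_i v_j = q_{ij} v_j v_i`. -/
abbrev QuantumSymmetricAlgebra (b : Module.Basis (Fin n) ℂ V) (q : Fin n → Fin n → ℂ) : Type _ :=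
  CommutationAlgebra b q

/-- The quantum exterior algebra `Λ_q(V)`: `v_i v_j = -q_{ij} v_j v_i`. -/
abbrev QuantumExteriorAlgebra (b : Module.Basis (Fin n) ℂ V) (q : Fin n → Fin n → ℂ) : Type _ :=
  CommutationAlgebra b (fun i j => -q i j)

/-- The action `φ` of `G` by algebra automorphisms extends the linear action `ρ` of `G` on `V`. -/
def ExtendsAction {G : Type*} [Group G] (ρ : Representation ℂ G V)
    (b : Module.Basis (Fin n) ℂ V) (c : Fin n → Fin n → ℂ)
    (φ : G →* (CommutationAlgebra b c ≃ₐ[ℂ] CommutationAlgebra b c)) : Prop :=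
  ∀ (g : G) (v : V), φ g (CommutationAlgebra.ι b c v) = CommutationAlgebra.ι b c (ρ g v)

end Quadratic

section TensorAction

variable {G : Type*} [Group G] {V : Type*} [AddCommGroup V] [Module ℂ V]

/-- The endomorphism of `T(V)` extending the action of `g` on `V`. -/
def tensorMap (ρ : Representation ℂ G V) (g : G) : TensorAlgebra ℂ V →ₐ[ℂ] TensorAlgebra ℂ V :=
  TensorAlgebra.lift ℂ (TensorAlgebra.ι ℂ ∘ₗ ρ g)

theorem tensorMap_ι (ρ : Representation ℂ G V) (g : G) (v : V) :
    tensorMap ρ g (TensorAlgebra.ι ℂ v) = TensorAlgebra.ι ℂ (ρ g v) := by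
  simp [tensorMap]

theorem tensorMap_one (ρ : Representation ℂ G V) :
    tensorMap ρ 1 = AlgHom.id ℂ (TensorAlgebra ℂ V) := by
  ext v
  simp [tensorMap_ι]

theorem tensorMap_mul (ρ : Representation ℂ G V) (g h : G) :
    tensorMap ρ (g * h) = (tensorMap ρ g).comp (tensorMap ρ h) := by
  ext v
  simp [tensorMap_ι]

/-- The action of `G` on `T(V)` by automorphisms induced by the action on `V`. -/
def tensorAction (ρ : Representation ℂ G V) :
    G →* (TensorAlgebra ℂ V ≃ₐ[ℂ] TensorAlgebra ℂ V) where
  toFun g := AlgEquiv.ofAlgHom (tensorMap ρ g) (tensorMap ρ g⁻¹)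
    (by rw [← tensorMap_mul, mul_inv_cancel, tensorMap_one])
    (by rw [← tensorMap_mul, inv_mul_cancel, tensorMap_one])
  map_one' := by
    ext x
    simp [tensorMap_one]
  map_mul' g h := by
    ext x
    simp [tensorMap_mul]

/-- The space `T(V)_{≤ m} = (ℂ + V)^m` of tensors of degree at most `m`. -/
def tensorLE (V : Type*) [AddCommGroup V] [Module ℂ V] (m : ℕ) :
    Submodule ℂ (TensorAlgebra ℂ V) :=
  (1 ⊔ LinearMap.range (TensorAlgebra.ι ℂ : V →ₗ[ℂ] TensorAlgebra ℂ V)) ^ m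

end TensorAction

/-! ### Filtered algebras and their associated graded algebras -/

/-- An increasing filtration of a `ℂ`-algebra, indexed by `ℕ`. -/
structure AlgebraFiltration (H : Type*) [Ring H] [Algebra ℂ H] where
  F : ℕ → Submodule ℂ H
  mono : Monotone F
  one_mem : (1 : H) ∈ F 0
  mul_mem : ∀ {i j : ℕ} {x y : H}, x ∈ F i → y ∈ F j → x * y ∈ F (i + j)

namespace AlgebraFiltration

variable {H : Type*} [Ring H] [Algebra ℂ H] (ℱ : AlgebraFiltration H)

/-- `F_{m-1}`, with the convention `F_{-1} = 0`. -/
def prev : ℕ → Submodule ℂ H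
  | 0 => ⊥
  | m + 1 => ℱ.F m

theorem prev_mul_mem {i j : ℕ} {x y : H} (hx : x ∈ ℱ.prev i) (hy : y ∈ ℱ.F j) :
    x * y ∈ ℱ.prev (i + j) := by
  cases i with
  | zero => rw [(Submodule.mem_bot ℂ).1 hx, zero_mul]; exact Submodule.zero_mem _
  | succ i => rw [Nat.succ_add]; exact ℱ.mul_mem hx hy

theorem mul_prev_mem {i j : ℕ} {x y : H} (hx : x ∈ ℱ.F i) (hy : y ∈ ℱ.prev j) :
    x * y ∈ ℱ.prev (i + j) := by
  cases j with
  | zero => rw [(Submodule.mem_bot ℂ).1 hy, mul_zero]; exact Submodule.zero_mem _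
  | succ j => exact ℱ.mul_mem hx hy

/-- `F_m / F_{m-1}`. -/
def GrPiece (m : ℕ) : Type _ :=
  ℱ.F m ⧸ (ℱ.prev m).submoduleOf (ℱ.F m)

instance (m : ℕ) : AddCommGroup (ℱ.GrPiece m) :=
  inferInstanceAs (AddCommGroup (ℱ.F m ⧸ (ℱ.prev m).submoduleOf (ℱ.F m)))

instance (m : ℕ) : Module ℂ (ℱ.GrPiece m) :=
  inferInstanceAs (Module ℂ (ℱ.F m ⧸ (ℱ.prev m).submoduleOf (ℱ.F m)))

/-- The class in `F_m / F_{m-1}` of an element of `F_m`. -/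
def toGr (m : ℕ) : ℱ.F m →ₗ[ℂ] ℱ.GrPiece m :=
  ((ℱ.prev m).submoduleOf (ℱ.F m)).mkQ

theorem toGr_surjective (m : ℕ) : Function.Surjective (ℱ.toGr m) :=
  Submodule.mkQ_surjective _

theorem toGr_eq_zero {m : ℕ} (x : ℱ.F m) (hx : (x : H) ∈ ℱ.prev m) : ℱ.toGr m x = 0 :=
  (Submodule.Quotient.mk_eq_zero _).2 hx

/-- The map `F_i × F_j → F_{i+j} / F_{i+j-1}` induced by multiplication. -/
def preMul (i j : ℕ) : ℱ.F i →ₗ[ℂ] ℱ.F j →ₗ[ℂ] ℱ.GrPiece (i + j) :=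
  LinearMap.mk₂ ℂ (fun x y => ℱ.toGr (i + j) ⟨x * y, ℱ.mul_mem x.2 y.2⟩)
    (fun x x' y => by rw [← map_add]; congr 1; ext; simp [add_mul])
    (fun r x y => by rw [← map_smul]; congr 1; ext; simp)
    (fun x y y' => by rw [← map_add]; congr 1; ext; simp [mul_add])
    (fun r x y => by rw [← map_smul]; congr 1; ext; simp)

/-- The multiplication `F_i/F_{i-1} × F_j/F_{j-1} → F_{i+j}/F_{i+j-1}`. -/
def grMul (i j : ℕ) : ℱ.GrPiece i →ₗ[ℂ] ℱ.GrPiece j →ₗ[ℂ] ℱ.GrPiece (i + j) :=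
  (((ℱ.prev j).submoduleOf (ℱ.F j)).liftQ
    (((ℱ.prev i).submoduleOf (ℱ.F i)).liftQ (ℱ.preMul i j)
      (fun x hx => LinearMap.ext fun y =>
        ℱ.toGr_eq_zero _ (ℱ.prev_mul_mem hx y.2))).flip
    (fun y hy => LinearMap.ext fun x => by
      obtain ⟨x, rfl⟩ := ℱ.toGr_surjective i x
      exact ℱ.toGr_eq_zero _ (ℱ.mul_prev_mem x.2 hy))).flip

theorem grMul_toGr {i j : ℕ} (x : ℱ.F i) (y : ℱ.F j) :
    ℱ.grMul i j (ℱ.toGr i x) (ℱ.toGr j y) =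
      ℱ.toGr (i + j) ⟨x * y, ℱ.mul_mem x.2 y.2⟩ := rfl

theorem mk_toGr_eq {i j : ℕ} (hij : i = j) {x : ℱ.F i} {y : ℱ.F j} (hxy : (x : H) = y) :
    (GradedMonoid.mk i (ℱ.toGr i x) : GradedMonoid ℱ.GrPiece) =
      GradedMonoid.mk j (ℱ.toGr j y) := by
  subst hij
  rw [Subtype.ext hxy]

instance : GradedMonoid.GMul ℱ.GrPiece where
  mul {i j} x y := ℱ.grMul i j x y

instance : GradedMonoid.GOne ℱ.GrPiece where
  one := ℱ.toGr 0 ⟨1, ℱ.one_mem⟩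

instance : GradedMonoid.GMonoid ℱ.GrPiece where
  one_mul := by
    rintro ⟨i, x⟩
    obtain ⟨x, rfl⟩ := ℱ.toGr_surjective i x
    exact ℱ.mk_toGr_eq (zero_add i) (one_mul (x : H))
  mul_one := by
    rintro ⟨i, x⟩
    obtain ⟨x, rfl⟩ := ℱ.toGr_surjective i x
    exact ℱ.mk_toGr_eq (add_zero i) (mul_one (x : H))
  mul_assoc := by
    rintro ⟨i, x⟩ ⟨j, y⟩ ⟨k, z⟩
    obtain ⟨x, rfl⟩ := ℱ.toGr_surjective i x
    obtain ⟨y, rfl⟩ := ℱ.toGr_surjective j y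
    obtain ⟨z, rfl⟩ := ℱ.toGr_surjective k z
    exact ℱ.mk_toGr_eq (add_assoc i j k) (mul_assoc (x : H) y z)

instance : DirectSum.GRing ℱ.GrPiece where
  mul_zero {i j} x := (ℱ.grMul i j x).map_zero
  zero_mul {i j} y := LinearMap.map_zero₂ (ℱ.grMul i j) y
  mul_add {i j} x y z := (ℱ.grMul i j x).map_add y z
  add_mul {i j} x y z := LinearMap.map_add₂ (ℱ.grMul i j) x y z
  natCast m := m • GradedMonoid.GOne.one
  natCast_zero := zero_smul ℕ _
  natCast_succ m := succ_nsmul _ m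
  intCast m := m • GradedMonoid.GOne.one
  intCast_ofNat m := natCast_zsmul _ m
  intCast_negSucc_ofNat m := negSucc_zsmul _ m

instance : DirectSum.GAlgebra ℂ ℱ.GrPiece where
  toFun := (LinearMap.toSpanSingleton ℂ (ℱ.GrPiece 0) (ℱ.toGr 0 ⟨1, ℱ.one_mem⟩)).toAddMonoidHom
  map_one := one_smul ℂ (ℱ.toGr 0 ⟨1, ℱ.one_mem⟩)
  map_mul r s := by
    refine ℱ.mk_toGr_eq (x := (r * s) • ⟨1, ℱ.one_mem⟩)
      (y := ⟨(r • (1 : H)) * (s • (1 : H)), _⟩) (zero_add 0).symm ?_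
    simp [mul_smul, smul_comm r s]
  commutes r := by
    rintro ⟨i, x⟩
    obtain ⟨x, rfl⟩ := ℱ.toGr_surjective i x
    refine ℱ.mk_toGr_eq (x := ⟨(r • (1 : H)) * x, _⟩)
      (y := ⟨x * (r • (1 : H)), _⟩) (add_comm 0 i) ?_
    simp
  smul_def r := by
    rintro ⟨i, x⟩
    obtain ⟨x, rfl⟩ := ℱ.toGr_surjective i x
    refine ℱ.mk_toGr_eq (x := r • x)
      (y := ⟨(r • (1 : H)) * x, _⟩) (zero_add i).symm ?_
    simp

/-- The associated graded algebra `gr H = ⨁ F_m / F_{m-1}`. -/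
abbrev Gr : Type _ := ⨁ m, ℱ.GrPiece m

/-- The homogeneous component of degree `m` of `gr H`. -/
def grComponent (m : ℕ) : Submodule ℂ ℱ.Gr :=
  LinearMap.range (DirectSum.lof ℂ ℕ ℱ.GrPiece m)

end AlgebraFiltration

/-! ### The algebras `H_{q,κ,α}` -/

section HeckeAlgebra

variable {G : Type*} [Group G] {n : ℕ} {V : Type*} [AddCommGroup V] [Module ℂ V]

theorem tensorLE_mono : Monotone (tensorLE V) :=
  fun _ _ h => pow_le_pow_right' le_sup_left h

theorem tensorAction_mem_tensorLE (ρ : Representation ℂ G V) (g : G) {m : ℕ}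
    {x : TensorAlgebra ℂ V} (hx : x ∈ tensorLE V m) : tensorAction ρ g x ∈ tensorLE V m := by
  have key : (tensorLE V m).map (tensorMap ρ g).toLinearMap ≤ tensorLE V m := by
    rw [tensorLE, Submodule.map_pow]
    refine pow_le_pow_left' ?_ m
    rw [Submodule.map_sup, Submodule.map_one]
    refine sup_le_sup le_rfl ?_
    rintro _ ⟨_, ⟨v, rfl⟩, rfl⟩
    exact ⟨ρ g v, (tensorMap_ι ρ g v).symm⟩
  exact key ⟨x, hx, rfl⟩

/-- The relations `v_i v_j - q_{ij} v_j v_i = κ(v_i, v_j)` in `T(V) #_α G`. -/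
inductive HeckeRel (ρ : Representation ℂ G V) (b : Module.Basis (Fin n) ℂ V)
    (q : Fin n → Fin n → ℂ) (α : NormalizedTwoCocycle G)
    (κ : V →ₗ[ℂ] V →ₗ[ℂ] TwistedGroupAlgebra α) :
    TwistedSkewGroupAlgebra (tensorAction ρ) α →
      TwistedSkewGroupAlgebra (tensorAction ρ) α → Prop
  | mk (i j : Fin n) : HeckeRel ρ b q α κ
      (TwistedSkewGroupAlgebra.single (tensorAction ρ) α 1
        (TensorAlgebra.ι ℂ (b i) * TensorAlgebra.ι ℂ (b j)
          - q i j • (TensorAlgebra.ι ℂ (b j) * TensorAlgebra.ι ℂ (b i))))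
      (groupInclusion (tensorAction ρ) α (κ (b i) (b j)))

/-- The algebra
`H_{q,κ,α} = T(V) #_α G / (v_i v_j - q_{ij} v_j v_i - κ(v_i, v_j) | 1 ≤ i, j ≤ n)`. -/
def HeckeAlgebra (ρ : Representation ℂ G V) (b : Module.Basis (Fin n) ℂ V)
    (q : Fin n → Fin n → ℂ) (α : NormalizedTwoCocycle G)
    (κ : V →ₗ[ℂ] V →ₗ[ℂ] TwistedGroupAlgebra α) : Type _ :=
  RingQuot (HeckeRel ρ b q α κ)

variable (ρ : Representation ℂ G V) (b : Module.Basis (Fin n) ℂ V)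
    (q : Fin n → Fin n → ℂ) (α : NormalizedTwoCocycle G)
    (κ : V →ₗ[ℂ] V →ₗ[ℂ] TwistedGroupAlgebra α)

instance : Ring (HeckeAlgebra ρ b q α κ) :=
  inferInstanceAs (Ring (RingQuot (HeckeRel ρ b q α κ)))

instance : Algebra ℂ (HeckeAlgebra ρ b q α κ) :=
  inferInstanceAs (Algebra ℂ (RingQuot (HeckeRel ρ b q α κ)))

/-- The quotient map `T(V) #_α G → H_{q,κ,α}`. -/
def HeckeAlgebra.mk :
    TwistedSkewGroupAlgebra (tensorAction ρ) α →ₐ[ℂ] HeckeAlgebra ρ b q α κ :=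
  RingQuot.mkAlgHom ℂ (HeckeRel ρ b q α κ)

/-- The filtration of `H_{q,κ,α}` with each `v_i` in degree one and each `t_g` in degree zero:
`F_m` is the image of `T(V)_{≤ m} ⊗ ℂG`. -/
def HeckeAlgebra.filtration : AlgebraFiltration (HeckeAlgebra ρ b q α κ) where
  F m := (TwistedSkewGroupAlgebra.coeffsIn (tensorAction ρ) α (tensorLE V m)).map
    (HeckeAlgebra.mk ρ b q α κ).toLinearMap
  mono i j h := Submodule.map_mono fun _ hx =>
    TwistedSkewGroupAlgebra.mem_coeffsIn.2 fun g =>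
      tensorLE_mono h (TwistedSkewGroupAlgebra.mem_coeffsIn.1 hx g)
  one_mem := by
    refine ⟨1, ?_, map_one (HeckeAlgebra.mk ρ b q α κ)⟩
    exact TwistedSkewGroupAlgebra.single_mem_coeffsIn 1
      (by rw [tensorLE, pow_zero]; exact Submodule.one_le.1 le_rfl)
  mul_mem := by
    rintro i j _ _ ⟨x, hx, rfl⟩ ⟨y, hy, rfl⟩
    refine ⟨x * y, ?_, map_mul (HeckeAlgebra.mk ρ b q α κ) x y⟩
    refine TwistedSkewGroupAlgebra.mul_mem_coeffsIn (fun g c d hc hd => ?_) hx hy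
    rw [tensorLE, pow_add]
    exact Submodule.mul_mem_mul hc (tensorAction_mem_tensorLE ρ g hd)

/-- `H_{q,κ,α}` is a twisted quantum Drinfeld Hecke algebra: `κ(v_i, v_j) = -q_{ij} κ(v_j, v_i)`,
and `gr H_{q,κ,α}` is isomorphic, as a graded algebra, to `S_q(V) #_α G`, where `φ` is the
action of `G` on `S_q(V)` by automorphisms. -/
structure IsTwistedQuantumDrinfeldHecke
    (φ : G →* (QuantumSymmetricAlgebra b q ≃ₐ[ℂ] QuantumSymmetricAlgebra b q)) : Prop where
  skew : ∀ i j, κ (b i) (b j) = -(q i j • κ (b j) (b i))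
  pbw : ∃ e : (HeckeAlgebra.filtration ρ b q α κ).Gr ≃ₐ[ℂ] TwistedSkewGroupAlgebra φ α,
    ∀ m : ℕ, ((HeckeAlgebra.filtration ρ b q α κ).grComponent m).map e.toLinearMap =
      TwistedSkewGroupAlgebra.coeffsIn φ α (CommutationAlgebra.piece b q m)

end HeckeAlgebra

/-! ### Constant Hochschild `2`-cocycles -/

/-- A bilinear map `μ : A × A → A` that satisfies the Hochschild `2`-cocycle condition. -/
def IsHochschildTwoCocycle {A : Type*} [Ring A] [Algebra ℂ A] (μ : A →ₗ[ℂ] A →ₗ[ℂ] A) : Prop :=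
  ∀ x y z : A, x * μ y z + μ x (y * z) = μ (x * y) z + μ x y * z

section Cocycles

variable {G : Type*} [Group G] {n : ℕ} {V : Type*} [AddCommGroup V] [Module ℂ V]
  {b : Module.Basis (Fin n) ℂ V} {q : Fin n → Fin n → ℂ} {α : NormalizedTwoCocycle G}
  {φ : G →* (QuantumSymmetricAlgebra b q ≃ₐ[ℂ] QuantumSymmetricAlgebra b q)}

/-- `μ` is homogeneous of degree `-2` on `A = S_q(V) #_α G`: it maps `A_i × A_j` to `A_{i+j-2}`,
which is `0` if `i + j < 2`. -/
def IsConstant (μ : TwistedSkewGroupAlgebra φ α →ₗ[ℂ] TwistedSkewGroupAlgebra φ α →ₗ[ℂ]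
    TwistedSkewGroupAlgebra φ α) : Prop :=
  ∀ (i j : ℕ) (x y : TwistedSkewGroupAlgebra φ α),
    x ∈ TwistedSkewGroupAlgebra.coeffsIn φ α (CommutationAlgebra.piece b q i) →
    y ∈ TwistedSkewGroupAlgebra.coeffsIn φ α (CommutationAlgebra.piece b q j) →
    (i + j < 2 → μ x y = 0) ∧
    (∀ k, i + j = k + 2 →
      μ x y ∈ TwistedSkewGroupAlgebra.coeffsIn φ α (CommutationAlgebra.piece b q k))

/-- `κ : V × V → ℂ^α G` is the quantum skew-symmetrization of `μ`:
`κ(v_i, v_j) = μ(v_i, v_j) - q_{ij} μ(v_j, v_i)`. -/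
def IsQuantumSkewSymmetrization (κ : V →ₗ[ℂ] V →ₗ[ℂ] TwistedGroupAlgebra α)
    (μ : TwistedSkewGroupAlgebra φ α →ₗ[ℂ] TwistedSkewGroupAlgebra φ α →ₗ[ℂ]
      TwistedSkewGroupAlgebra φ α) : Prop :=
  ∀ i j : Fin n, groupInclusion φ α (κ (b i) (b j)) =
    μ (TwistedSkewGroupAlgebra.single φ α 1 (CommutationAlgebra.ι b q (b i)))
        (TwistedSkewGroupAlgebra.single φ α 1 (CommutationAlgebra.ι b q (b j)))
      - q i j • μ (TwistedSkewGroupAlgebra.single φ α 1 (CommutationAlgebra.ι b q (b j)))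
        (TwistedSkewGroupAlgebra.single φ α 1 (CommutationAlgebra.ι b q (b i)))

end Cocycles

end QDHA

end

/-! The argument has two halves. First, the cocycle identity turns into conditions on κ. By degree,
μ vanishes on a pair consisting of a vector and a group element, and μ(v, w) lies in degree zero, so
κ exists with values in ℂ^α G and is unique. Evaluating the cocycle identity on triples made of t_g
and two vectors shows that conjugation by t_g preserves the span of the relations v_i v_j - q_{ij}
v_j v_i - κ(v_i, v_j). Evaluating it on the six orderings of v_i, v_j, v_k gives a quantum Jacobi
identity. These identities hold in S_q(V) #_α G. They lift to T(V) #_α G because the kernel of T(V)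
→ S_q(V) begins in degree two (`tensorComponent_of_toSymm_eq_zero`). The outcome is
`IsQuantumSkewSymmetrization.pbwConditions`.

Second, these conditions imply the PBW property. A function Φ from words to S_q(V) #_α G is built by
induction on the length, with Φ(… v_i v_j …) - q_{ij} Φ(… v_j v_i …) = Φ(… κ(v_i, v_j) …) and with
leading term the class of the word. At each length the right-hand side is already known, so a
function with prescribed skew differences is needed. Bubble sort provides one, and a diamond
argument shows that the order of the swaps is irrelevant: disjoint swaps commute by the relations
for shorter words, and overlapping swaps agree by the Jacobi identity (`reduceWord_descent`,
`IsReduction.exists_succ`).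

Such a Φ factors through H_{q,κ,α}, and its leading components give linear maps F_m / F_{m-1} →
S_q(V) #_α G. They are injective because the kernel of T(V) → S_q(V) drops in filtration degree
inside H_{q,κ,α} (`mk_mem_prev`). Together they form the graded isomorphism of `exists_gr_algEquiv`.
No monomial basis of S_q(V) is required: S_q(V) #_α G itself is the target of Φ. -/

noncomputable section

open scoped DirectSum

namespace QDHA

open TwistedSkewGroupAlgebra

/-! ### Kernels of quotients by relations -/

/-- A subspace that is stable under multiplication from both sides and contains the differences
of related elements contains the differences of all elements with the same class. -/
theorem sub_mem_of_mkAlgHom_eq {R : Type*} [Ring R] [Algebra ℂ R] {r : R → R → Prop}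
    (N : Submodule ℂ R) (hl : ∀ x y, y ∈ N → x * y ∈ N) (hr : ∀ x y, x ∈ N → x * y ∈ N)
    (h : ∀ x y, r x y → x - y ∈ N) {x y : R}
    (hxy : RingQuot.mkAlgHom ℂ r x = RingQuot.mkAlgHom ℂ r y) : x - y ∈ N := by
  let I : TwoSidedIdeal R := TwoSidedIdeal.mk' N N.zero_mem (fun hx hy => N.add_mem hx hy)
    (fun hx => N.neg_mem hx) (fun hy => hl _ _ hy) (fun hx => hr _ _ hx)
  have hI : ∀ z, z ∈ I ↔ z ∈ N := fun z => TwoSidedIdeal.mem_mk' _ _ _ _ _ _ z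
  -- The relations hold in R / I, so the projection to R / I factors through `RingQuot r`; elements
  -- with the same class are therefore congruent modulo I.
  let f : RingQuot r →+* I.ringCon.Quotient := RingQuot.lift ⟨I.ringCon.mk', fun x y hxy =>
    (RingCon.eq _).2 ((I.rel_iff x y).2 ((hI _).2 (h x y hxy)))⟩
  have hf : ∀ z, f (RingQuot.mkAlgHom ℂ r z) = I.ringCon.mk' z := fun z => by
    rw [← AlgHom.coe_toRingHom, RingQuot.mkAlgHom_coe]
    exact RingQuot.lift_mkRingHom_apply _ _ _
  have := congrArg f hxy
  rw [hf, hf] at this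
  exact (hI _).1 ((I.rel_iff x y).1 ((RingCon.eq _).1 this))

/-! ### Functions on words with prescribed skew differences -/

/-- The number of inversions of a word. -/
def inversions {n : ℕ} : List (Fin n) → ℕ
  | [] => 0
  | a :: w => w.countP (· < a) + inversions w

/-- The swap removes the inversion formed by the two letters and keeps the relative order of every
other pair. This is the termination measure for sorting. -/
theorem inversions_swap_lt {n : ℕ} (u v : List (Fin n)) {a b : Fin n} (h : b < a) :
    inversions (u ++ b :: a :: v) < inversions (u ++ a :: b :: v) := by
  induction u with
  | nil =>
    simp only [List.nil_append, inversions, List.countP_cons]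
    simp [h, h.not_gt]
    omega
  | cons c u ih =>
    simp only [List.cons_append, inversions, List.countP_append, List.countP_cons]
    omega

section Words

variable {n : ℕ} {W : Type*} [AddCommGroup W] [Module ℂ W]

open Classical in
/-- The function on words that vanishes on sorted words and is computed by removing descents. -/
def reduceWord (q : Fin n → Fin n → ℂ)
    (D : List (Fin n) → Fin n → Fin n → List (Fin n) → W) (w : List (Fin n)) : W :=
  -- The descent is picked by choice; `reduceWord_descent` shows, under conditions on D, that any
  -- other descent gives the same value.
  if h : ∃ p : List (Fin n) × Fin n × Fin n × List (Fin n),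
      w = p.1 ++ p.2.1 :: p.2.2.1 :: p.2.2.2 ∧ p.2.2.1 < p.2.1 then
    q h.choose.2.1 h.choose.2.2.1 •
      reduceWord q D (h.choose.1 ++ h.choose.2.2.1 :: h.choose.2.1 :: h.choose.2.2.2) +
    D h.choose.1 h.choose.2.1 h.choose.2.2.1 h.choose.2.2.2
  else 0
termination_by inversions w
decreasing_by
  conv_rhs => rw [h.choose_spec.1]
  exact inversions_swap_lt _ _ h.choose_spec.2

/-- A swap keeps the length, so every term collected by the recursion is a value of D at length m.
In the application S is a bound on the degree. -/
theorem reduceWord_mem (q : Fin n → Fin n → ℂ)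
    (D : List (Fin n) → Fin n → Fin n → List (Fin n) → W) (S : Submodule ℂ W) (m : ℕ)
    (hD : ∀ u a b v, (u ++ a :: b :: v).length = m → D u a b v ∈ S) (w : List (Fin n))
    (hw : w.length = m) : reduceWord q D w ∈ S := by
  induction hk : inversions w using Nat.strong_induction_on generalizing w with
  | _ k ih =>
    rw [reduceWord]
    split_ifs with h
    · have hs := h.choose_spec
      have hl : (h.choose.1 ++ h.choose.2.1 :: h.choose.2.2.1 :: h.choose.2.2.2).length = m := by
        rw [← hs.1, hw]
      refine S.add_mem (S.smul_mem _ (ih _ ?_ _ ?_ rfl)) (hD _ _ _ _ hl)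
      · rw [← hk]
        conv_rhs => rw [hs.1]
        exact inversions_swap_lt _ _ hs.2
      · simpa using hl
    · exact S.zero_mem

variable {q : Fin n → Fin n → ℂ} {D : List (Fin n) → Fin n → Fin n → List (Fin n) → W} {m : ℕ}

/-- The conditions on `D` at overlapping and at disjoint descents make `reduceWord` independent
of the order in which descents are removed. -/
theorem reduceWord_descent
    (comm : ∀ u a b v c d w, (u ++ a :: b :: (v ++ c :: d :: w)).length = m →
      D u a b (v ++ c :: d :: w) + q a b • D (u ++ b :: a :: v) c d w =
        D (u ++ a :: b :: v) c d w + q c d • D u a b (v ++ d :: c :: w))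
    (braid : ∀ u a b c w, (u ++ a :: b :: c :: w).length = m →
      D u a b (c :: w) + q a b • D (u ++ [b]) a c w + (q a b * q a c) • D u b c (a :: w) =
        D (u ++ [a]) b c w + q b c • D u a c (b :: w) + (q b c * q a c) • D (u ++ [c]) a b w)
    (w u : List (Fin n)) (a b : Fin n) (v : List (Fin n)) (hw : w.length = m)
    (h : w = u ++ a :: b :: v) (hab : b < a) :
    reduceWord q D w = q a b • reduceWord q D (u ++ b :: a :: v) + D u a b v := by
  induction hk : inversions w using Nat.strong_induction_on generalizing w u a b v with
  | _ k ih =>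
    -- Two descents of the same word are compared, the second starting `t.length` letters after the
    -- first. They coincide, share one letter or are disjoint according to whether t has length
    -- zero, one or more. The induction hypothesis applies after any swap.
    have key : ∀ (u : List (Fin n)) (a b : Fin n) (v u' : List (Fin n)) (c d : Fin n)
        (v' : List (Fin n)) (t : List (Fin n)), w = u ++ a :: b :: v →
        b < a → d < c → u' = u ++ t → a :: b :: v = t ++ c :: d :: v' →
        q a b • reduceWord q D (u ++ b :: a :: v) + D u a b v =
          q c d • reduceWord q D (u' ++ d :: c :: v') + D u' c d v' := by
      rintro u a b v u' c d v' t rfl hab hcd rfl ht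
      have hlen : (u ++ b :: a :: v).length = m := by rw [← hw]; simp
      have hlt : inversions (u ++ b :: a :: v) < k := hk ▸ inversions_swap_lt u v hab
      match t, ht with
      | [], ht =>
        simp only [List.nil_append, List.cons.injEq] at ht
        obtain ⟨rfl, rfl, rfl⟩ := ht
        simp
      -- Here d < b < a are consecutive. Both sides of the hexagon are followed down to the sorted
      -- triple d, b, a, and `braid` says that the accumulated corrections agree.
      | [x], ht =>
        simp only [List.cons_append, List.nil_append, List.cons.injEq] at ht
        obtain ⟨rfl, rfl, rfl⟩ := ht
        have hlt' : inversions (u ++ a :: d :: b :: v') < k := by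
          have := inversions_swap_lt (u ++ [a]) v' hcd
          simp only [List.append_assoc, List.cons_append, List.nil_append] at this
          omega
        have e1 := ih _ hlt (u ++ b :: a :: d :: v') (u ++ [b]) a d v' hlen (by simp)
          (hcd.trans hab) rfl
        have hlt1 := inversions_swap_lt (u ++ [b]) v' (hcd.trans hab)
        have e2 := ih _ (lt_trans (by simpa using hlt1) hlt) (u ++ b :: d :: a :: v') u b d
          (a :: v') (by simpa using hlen) rfl hcd rfl
        have e3 := ih _ hlt' (u ++ a :: d :: b :: v') u a d (b :: v') (by simpa using hlen) rfl
          (hcd.trans hab) rfl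
        have hlt2 := inversions_swap_lt u (b :: v') (hcd.trans hab)
        have e4 := ih _ (hlt2.trans hlt') (u ++ d :: a :: b :: v') (u ++ [d]) a b v'
          (by simpa using hlen) (by simp) hab rfl
        have hb := braid u a b d v' (by simpa using hlen)
        simp only [List.append_assoc, List.cons_append, List.nil_append] at e1 e2 e3 e4 hb ⊢
        rw [e1, e2, e3, e4]
        linear_combination (norm := module) hb
      -- Performing the two disjoint swaps in either order leads to the same word, and `comm`
      -- compares the corrections.
      | x :: y :: t, ht =>
        simp only [List.cons_append, List.cons.injEq] at ht
        obtain ⟨rfl, rfl, rfl⟩ := ht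
        have hlt' : inversions (u ++ a :: b :: (t ++ d :: c :: v')) < k := by
          have := inversions_swap_lt (u ++ a :: b :: t) v' hcd
          simp only [List.append_assoc, List.cons_append] at this
          omega
        have e1 := ih _ hlt (u ++ b :: a :: (t ++ c :: d :: v')) (u ++ b :: a :: t) c d v' hlen
          (by simp) hcd rfl
        have e2 := ih _ hlt' (u ++ a :: b :: (t ++ d :: c :: v')) u a b (t ++ d :: c :: v')
          (by simpa using hlen) rfl hab rfl
        have hc := comm u a b t c d v' (by simpa using hlen)
        simp only [List.append_assoc, List.cons_append] at e1 e2 hc ⊢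
        rw [e1, e2]
        linear_combination (norm := module) hc
    have hex : ∃ p : List (Fin n) × Fin n × Fin n × List (Fin n),
      w = p.1 ++ p.2.1 :: p.2.2.1 :: p.2.2.2 ∧ p.2.2.1 < p.2.1 := ⟨(u, a, b, v), h, hab⟩
    rw [reduceWord, dif_pos hex]
    have hs := hex.choose_spec
    generalize hex.choose = p at hs
    obtain ⟨u', c, d, v'⟩ := p
    obtain ⟨hs, hcd⟩ := hs
    simp only at hs hcd ⊢
    -- The chosen descent is either to the right or to the left of the given one; `key` is applied
    -- with the leftmost one first.
    rcases List.append_eq_append_iff.1 (h.symm.trans hs) with ⟨t, h1, h2⟩ | ⟨t, h1, h2⟩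
    · exact (key _ _ _ _ _ _ _ _ t h hab hcd h1 h2).symm
    · exact key _ _ _ _ _ _ _ _ t hs hcd hab h1 h2

/-- Existence of a function on words of length `m` with prescribed skew differences `D`. -/
theorem exists_skew_difference_eq (hq : IsQuantumParameter q)
    (skew : ∀ u a b v, D u a b v = -(q a b • D u b a v))
    (comm : ∀ u a b v c d w, (u ++ a :: b :: (v ++ c :: d :: w)).length = m →
      D u a b (v ++ c :: d :: w) + q a b • D (u ++ b :: a :: v) c d w =
        D (u ++ a :: b :: v) c d w + q c d • D u a b (v ++ d :: c :: w))
    (braid : ∀ u a b c w, (u ++ a :: b :: c :: w).length = m →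
      D u a b (c :: w) + q a b • D (u ++ [b]) a c w + (q a b * q a c) • D u b c (a :: w) =
        D (u ++ [a]) b c w + q b c • D u a c (b :: w) + (q b c * q a c) • D (u ++ [c]) a b w)
    (S : Submodule ℂ W) (hS : ∀ u a b v, (u ++ a :: b :: v).length = m → D u a b v ∈ S) :
    ∃ f : List (Fin n) → W, (∀ w, w.length = m → f w ∈ S) ∧
      ∀ u a b v, (u ++ a :: b :: v).length = m →
        f (u ++ a :: b :: v) - q a b • f (u ++ b :: a :: v) = D u a b v := by
  refine ⟨reduceWord q D, fun w hw => reduceWord_mem q D S m hS w hw, fun u a b v h => ?_⟩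
  rcases lt_trichotomy b a with hab | rfl | hab
  · rw [reduceWord_descent comm braid _ u a b v h rfl hab]
    abel
  -- For equal letters q is 1, so skewness reads D = -D.
  · have h0 := skew u b b v
    rw [hq.diag, one_smul] at h0
    have h2 : (2 : ℂ) • D u b b v = 0 := by linear_combination (norm := module) h0
    rw [hq.diag, one_smul, sub_self, (smul_eq_zero.1 h2).resolve_left two_ne_zero]
  -- An ascent becomes a descent after the swap; skewness and the inverse relation between q_{ij}
  -- and q_{ji} convert one equation into the other.
  · have h1 := reduceWord_descent comm braid _ u b a v (by simpa using h) rfl hab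
    rw [h1, skew u a b v, smul_add, smul_smul, hq.inv a b, mul_inv_cancel₀ (hq.ne_zero a b),
      one_smul]
    abel

end Words

/-! ### Coefficientwise maps of twisted skew group algebras -/

namespace TwistedSkewGroupAlgebra

variable {G A B : Type*} [Group G] [Ring A] [Algebra ℂ A] [Ring B] [Algebra ℂ B]
  {φ : G →* (A ≃ₐ[ℂ] A)} {ψ : G →* (B ≃ₐ[ℂ] B)}
  {α : NormalizedTwoCocycle G}

theorem ext_coeff {x y : TwistedSkewGroupAlgebra φ α} (h : ∀ g, coeff φ α g x = coeff φ α g y) :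
    x = y :=
  Finsupp.ext h

theorem coeffsIn_le {W : Submodule ℂ A} {N : Submodule ℂ (TwistedSkewGroupAlgebra φ α)}
    (h : ∀ g, W ≤ N.comap (single φ α g)) : coeffsIn φ α W ≤ N := by
  intro x hx
  have hx' : x = (toFinsupp φ α x).sum fun g a => single φ α g a :=
    (Finsupp.sum_single (toFinsupp φ α x)).symm
  rw [hx']
  exact N.sum_mem fun g _ => h g (mem_coeffsIn.1 hx g)

theorem single_one_mul_single_one (a b : A) :
    single φ α 1 a * single φ α 1 b = single φ α 1 (a * b) := by
  simp [single_mul_single, α.map_one_left]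

theorem single_one_mul_single (g : G) (a b : A) :
    single φ α 1 a * single φ α g b = single φ α g (a * b) := by
  simp [single_mul_single, α.map_one_left]

theorem single_mul_single_one (g : G) (a b : A) :
    single φ α g a * single φ α 1 b = single φ α g (a * φ g b) := by
  simp [single_mul_single, α.map_one_right]

theorem single_eq_mul (g : G) (a : A) :
    single φ α g a = single φ α 1 a * single φ α g 1 := by
  rw [single_one_mul_single, mul_one]

theorem single_one_swap (g : G) (a : A) :
    single φ α g 1 * single φ α 1 a = single φ α 1 (φ g a) * single φ α g 1 := by
  rw [single_mul_single_one, single_one_mul_single, one_mul, mul_one]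

/-- The linear map that applies `f` to all coefficients. -/
def mapCoeffs (φ : G →* (A ≃ₐ[ℂ] A)) (ψ : G →* (B ≃ₐ[ℂ] B)) (α : NormalizedTwoCocycle G)
    (f : A →ₗ[ℂ] B) : TwistedSkewGroupAlgebra φ α →ₗ[ℂ] TwistedSkewGroupAlgebra ψ α :=
  (toFinsupp ψ α).symm.toLinearMap ∘ₗ Finsupp.mapRange.linearMap f ∘ₗ
    (toFinsupp φ α).toLinearMap

theorem coeff_mapCoeffs (f : A →ₗ[ℂ] B) (g : G) (x : TwistedSkewGroupAlgebra φ α) :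
    coeff ψ α g (mapCoeffs φ ψ α f x) = f (coeff φ α g x) := rfl

theorem mapCoeffs_single (f : A →ₗ[ℂ] B) (g : G) (a : A) :
    mapCoeffs φ ψ α f (single φ α g a) = single ψ α g (f a) :=
  Finsupp.mapRange_single (hf := map_zero f)

/-- Right multiplication by t_g only relabels and rescales coefficients, since the action fixes 1.
Hence f may be any linear map, with no equivariance. -/
theorem mapCoeffs_mul_single (f : A →ₗ[ℂ] A) (x : TwistedSkewGroupAlgebra φ α) (g : G) :
    mapCoeffs φ φ α f (x * single φ α g 1) = mapCoeffs φ φ α f x * single φ α g 1 := by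
  induction x using induction_linear with
  | zero => simp
  | add x y hx hy => rw [add_mul, map_add, hx, hy, map_add, add_mul]
  | single h a =>
    simp [single_mul_single, mapCoeffs_single]

/-- The algebra homomorphism that applies an equivariant homomorphism to all coefficients. -/
def map (f : A →ₐ[ℂ] B) (hf : ∀ g a, f (φ g a) = ψ g (f a)) :
    TwistedSkewGroupAlgebra φ α →ₐ[ℂ] TwistedSkewGroupAlgebra ψ α :=
  AlgHom.ofLinearMap (mapCoeffs φ ψ α f.toLinearMap)
    (by rw [one_def, mapCoeffs_single, AlgHom.toLinearMap_apply, map_one, one_def])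
    (by
      intro x y
      induction x using induction_linear with
      | zero => simp
      | add x₁ x₂ h₁ h₂ => simp only [add_mul, map_add, h₁, h₂]
      | single g a =>
        induction y using induction_linear with
        | zero => simp
        | add y₁ y₂ h₁ h₂ => simp only [mul_add, map_add, h₁, h₂]
        | single h b => simp [single_mul_single, mapCoeffs_single, hf])

theorem map_apply (f : A →ₐ[ℂ] B) (hf : ∀ g a, f (φ g a) = ψ g (f a))
    (x : TwistedSkewGroupAlgebra φ α) :
    map f hf x = mapCoeffs φ ψ α f.toLinearMap x := rfl

theorem map_single (f : A →ₐ[ℂ] B) (hf : ∀ g a, f (φ g a) = ψ g (f a)) (g : G) (a : A) :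
    map f hf (single φ α g a) = single ψ α g (f a) :=
  mapCoeffs_single _ _ _

end TwistedSkewGroupAlgebra

/-! ### The twisted group algebra inside a twisted skew group algebra. -/

section GroupInclusion

variable {G A B : Type*} [Group G] [Ring A] [Algebra ℂ A] [Ring B] [Algebra ℂ B]
  {φ : G →* (A ≃ₐ[ℂ] A)} {ψ : G →* (B ≃ₐ[ℂ] B)} {α : NormalizedTwoCocycle G}

theorem coeff_groupInclusion (g : G) (k : TwistedGroupAlgebra α) :
    coeff φ α g (groupInclusion φ α k) = algebraMap ℂ A (coeff 1 α g k) := rfl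

theorem groupInclusion_mem (k : TwistedGroupAlgebra α) :
    groupInclusion φ α k ∈ coeffsIn φ α 1 :=
  mem_coeffsIn.2 fun g => by
    rw [coeff_groupInclusion]
    exact Submodule.algebraMap_mem _

theorem groupInclusion_injective [Nontrivial A] : Function.Injective (groupInclusion φ α) := by
  intro k k' h
  refine ext_coeff fun g => (algebraMap ℂ A).injective ?_
  rw [← coeff_groupInclusion (φ := φ), h, coeff_groupInclusion]

theorem exists_groupInclusion_eq [Finite G] {x : TwistedSkewGroupAlgebra φ α}
    (hx : x ∈ coeffsIn φ α 1) : ∃ k, groupInclusion φ α k = x := by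
  choose k hk using fun g => Submodule.mem_one.1 (mem_coeffsIn.1 hx g)
  exact ⟨(toFinsupp 1 α).symm (Finsupp.equivFunOnFinite.symm k), ext_coeff hk⟩

theorem map_groupInclusion (f : A →ₐ[ℂ] B) (hf : ∀ g a, f (φ g a) = ψ g (f a))
    (k : TwistedGroupAlgebra α) : map f hf (groupInclusion φ α k) = groupInclusion ψ α k :=
  ext_coeff fun _ => f.commutes _

end GroupInclusion

/-! ### Words and degrees -/

section Degree

variable {n : ℕ} {V : Type*} [AddCommGroup V] [Module ℂ V]

/-- The linear map `v ↦ ι(v) X`. -/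
def iotaX {B : Type*} [Ring B] [Algebra ℂ B] (ι : V →ₗ[ℂ] B) : V →ₗ[ℂ] Polynomial B :=
  (Polynomial.monomial 1 : B →ₗ[B] Polynomial B).restrictScalars ℂ ∘ₗ ι

/-- The linear map that extracts the coefficient of `X ^ k`. -/
def coeffX (B : Type*) [Ring B] [Algebra ℂ B] (k : ℕ) : Polynomial B →ₗ[ℂ] B :=
  (Polynomial.lcoeff B k).restrictScalars ℂ

theorem coeffX_apply {B : Type*} [Ring B] [Algebra ℂ B] (k : ℕ) (p : Polynomial B) :
    coeffX B k p = p.coeff k := rfl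

/-- The homomorphism `T(V) → T(V)[X]` that multiplies each vector by `X`. -/
def tensorHomogenize (V : Type*) [AddCommGroup V] [Module ℂ V] :
    TensorAlgebra ℂ V →ₐ[ℂ] Polynomial (TensorAlgebra ℂ V) :=
  TensorAlgebra.lift ℂ (iotaX (TensorAlgebra.ι ℂ))

theorem tensorHomogenize_ι (v : V) : tensorHomogenize V (TensorAlgebra.ι ℂ v) =
    Polynomial.monomial 1 (TensorAlgebra.ι ℂ v) :=
  TensorAlgebra.lift_ι_apply _ _

/-- The projection of `T(V)` onto the tensors of degree `k`. -/
def tensorComponent (V : Type*) [AddCommGroup V] [Module ℂ V] (k : ℕ) :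
    TensorAlgebra ℂ V →ₗ[ℂ] TensorAlgebra ℂ V :=
  coeffX _ k ∘ₗ (tensorHomogenize V).toLinearMap

/-- Components are coefficients of an algebra homomorphism into T(V)[X], so this is the coefficient
formula for products of polynomials. -/
theorem tensorComponent_mul (k : ℕ) (x y : TensorAlgebra ℂ V) :
    tensorComponent V k (x * y) = ∑ p ∈ Finset.HasAntidiagonal.antidiagonal k,
      tensorComponent V p.1 x * tensorComponent V p.2 y := by
  simp [tensorComponent, coeffX_apply, Polynomial.coeff_mul]

/-- The product of the basis vectors with the indices in `w`. -/
def word (b : Module.Basis (Fin n) ℂ V) (w : List (Fin n)) : TensorAlgebra ℂ V :=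
  (w.map fun i => TensorAlgebra.ι ℂ (b i)).prod

variable (b : Module.Basis (Fin n) ℂ V)

theorem word_nil : word b [] = 1 := rfl

theorem word_cons (i : Fin n) (w : List (Fin n)) :
    word b (i :: w) = TensorAlgebra.ι ℂ (b i) * word b w := by
  simp [word]

theorem word_append (w w' : List (Fin n)) : word b (w ++ w') = word b w * word b w' := by
  simp [word]

theorem word_singleton (i : Fin n) : word b [i] = TensorAlgebra.ι ℂ (b i) := by
  simp [word]

theorem tensorHomogenize_word (w : List (Fin n)) :
    tensorHomogenize V (word b w) = Polynomial.monomial w.length (word b w) := by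
  induction w with
  | nil => rw [word_nil, map_one, List.length_nil, Polynomial.monomial_zero_one]
  | cons i w ih =>
    rw [word_cons, map_mul, ih, tensorHomogenize_ι, Polynomial.monomial_mul_monomial,
      List.length_cons, add_comm]

theorem tensorComponent_word (k : ℕ) (w : List (Fin n)) :
    tensorComponent V k (word b w) = if w.length = k then word b w else 0 := by
  change (tensorHomogenize V (word b w)).coeff k = _
  rw [tensorHomogenize_word, Polynomial.coeff_monomial]

/-- Makes words available as a basis of T(V), so that linear maps out of T(V) can be prescribed
freely on words. -/
theorem tensorAlgebra_basis_apply (w : List (Fin n)) :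
    b.tensorAlgebra (FreeMonoid.ofList w) = word b w := by
  have h : FreeAlgebra.basisFreeMonoid ℂ (Fin n) (FreeMonoid.ofList w) =
      (w.map (FreeAlgebra.ι ℂ)).prod := by
    rw [FreeAlgebra.basisFreeMonoid, Module.Basis.map_apply, Finsupp.coe_basisSingleOne]
    change FreeAlgebra.equivMonoidAlgebraFreeMonoid.symm
      (MonoidAlgebra.of ℂ (FreeMonoid (Fin n)) (FreeMonoid.ofList w)) = _
    change MonoidAlgebra.lift ℂ _ _ _ _ = _
    rw [MonoidAlgebra.lift_of, FreeMonoid.lift_ofList]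
  rw [Module.Basis.tensorAlgebra, Module.Basis.map_apply, h]
  change (TensorAlgebra.equivFreeAlgebra b).symm _ = _
  rw [map_list_prod, List.map_map, word]
  congr 1
  exact List.map_congr_left fun i _ => TensorAlgebra.equivFreeAlgebra_symm_ι b i

theorem span_word : Submodule.span ℂ (Set.range (word b)) = ⊤ := by
  rw [← b.tensorAlgebra.span_eq]
  congr 1
  ext x
  constructor
  · rintro ⟨w, rfl⟩
    exact ⟨_, tensorAlgebra_basis_apply b w⟩
  · rintro ⟨w, rfl⟩
    exact ⟨w.toList, (tensorAlgebra_basis_apply b w.toList).symm⟩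

theorem range_ι_eq_span : LinearMap.range (TensorAlgebra.ι ℂ : V →ₗ[ℂ] TensorAlgebra ℂ V) =
    Submodule.span ℂ {x | ∃ w : List (Fin n), w.length = 1 ∧ word b w = x} := by
  rw [LinearMap.range_eq_map, ← b.span_eq, Submodule.map_span]
  congr 1
  ext x
  constructor
  · rintro ⟨_, ⟨i, rfl⟩, rfl⟩
    exact ⟨[i], rfl, word_singleton b i⟩
  · rintro ⟨w, hw, rfl⟩
    obtain ⟨i, rfl⟩ := List.length_eq_one_iff.1 hw
    exact ⟨b i, ⟨i, rfl⟩, (word_singleton b i).symm⟩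

theorem tensorLE_eq_span (m : ℕ) : tensorLE V m =
    Submodule.span ℂ {x | ∃ w : List (Fin n), w.length ≤ m ∧ word b w = x} := by
  have h1 : (1 ⊔ LinearMap.range (TensorAlgebra.ι ℂ : V →ₗ[ℂ] TensorAlgebra ℂ V)) =
      Submodule.span ℂ {x | ∃ w : List (Fin n), w.length ≤ 1 ∧ word b w = x} := by
    rw [range_ι_eq_span b, Submodule.one_eq_span, ← Submodule.span_union]
    congr 1
    ext x
    constructor
    · rintro (rfl | ⟨w, hw, rfl⟩)
      · exact ⟨[], by simp, rfl⟩
      · exact ⟨w, hw.le, rfl⟩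
    · rintro ⟨w, hw, rfl⟩
      rcases Nat.le_one_iff_eq_zero_or_eq_one.1 hw with h | h
      · left
        rw [List.length_eq_zero_iff.1 h]
        rfl
      · exact Or.inr ⟨w, h, rfl⟩
  induction m with
  | zero =>
    rw [tensorLE, pow_zero, Submodule.one_eq_span]
    congr 1
    ext x
    constructor
    · rintro rfl
      exact ⟨[], by simp, rfl⟩
    · rintro ⟨w, hw, rfl⟩
      rw [List.length_eq_zero_iff.1 (Nat.le_zero.1 hw)]
      rfl
  | succ m ih =>
    rw [tensorLE, pow_succ, ← tensorLE, ih, h1, Submodule.span_mul_span]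
    congr 1
    ext x
    constructor
    · rintro ⟨_, ⟨w, hw, rfl⟩, _, ⟨w', hw', rfl⟩, rfl⟩
      exact ⟨w ++ w', by simp; omega, word_append b w w'⟩
    · rintro ⟨w, hw, rfl⟩
      -- A word of length at most m + 1 is cut after m letters, leaving at most one letter.
      refine ⟨word b (w.take m), ⟨_, by simp, rfl⟩, word b (w.drop m),
        ⟨_, by simp; omega, rfl⟩, ?_⟩
      change word b _ * word b _ = _
      rw [← word_append, List.take_append_drop]

theorem word_mem_tensorLE {m : ℕ} {w : List (Fin n)} (hw : w.length ≤ m) :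
    word b w ∈ tensorLE V m := by
  rw [tensorLE_eq_span b]
  exact Submodule.subset_span ⟨w, hw, rfl⟩

end Degree

/-! ### Homogeneous components of tensors. -/

section TensorComponents

variable {n : ℕ} {V : Type*} [AddCommGroup V] [Module ℂ V]

theorem tensorComponent_ι (k : ℕ) (v : V) : tensorComponent V k (TensorAlgebra.ι ℂ v) =
    if k = 1 then TensorAlgebra.ι ℂ v else 0 := by
  change (tensorHomogenize V _).coeff k = _
  rw [tensorHomogenize_ι, Polynomial.coeff_monomial]
  simp [eq_comm]

theorem tensorComponent_one (k : ℕ) : tensorComponent V k 1 = if k = 0 then 1 else 0 := by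
  change (tensorHomogenize V 1).coeff k = _
  rw [map_one, Polynomial.coeff_one]

theorem tensorComponent_ι_mul_ι (k : ℕ) (v w : V) :
    tensorComponent V k (TensorAlgebra.ι ℂ v * TensorAlgebra.ι ℂ w) =
      if k = 2 then TensorAlgebra.ι ℂ v * TensorAlgebra.ι ℂ w else 0 := by
  change (tensorHomogenize V _).coeff k = _
  rw [map_mul, tensorHomogenize_ι, tensorHomogenize_ι, Polynomial.monomial_mul_monomial,
    Polynomial.coeff_monomial]
  simp [eq_comm]

theorem tensorComponent_of_mem_one {k : ℕ} {x : TensorAlgebra ℂ V}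
    (hx : x ∈ (1 : Submodule ℂ (TensorAlgebra ℂ V))) :
    tensorComponent V k x = if k = 0 then x else 0 := by
  obtain ⟨c, rfl⟩ := Submodule.mem_one.1 hx
  rw [Algebra.algebraMap_eq_smul_one, map_smul, tensorComponent_one]
  split_ifs <;> simp

theorem tensorComponent_zero_mem_one (b : Module.Basis (Fin n) ℂ V) (x : TensorAlgebra ℂ V) :
    tensorComponent V 0 x ∈ (1 : Submodule ℂ (TensorAlgebra ℂ V)) := by
  have h : (⊤ : Submodule ℂ (TensorAlgebra ℂ V)) ≤
      (1 : Submodule ℂ (TensorAlgebra ℂ V)).comap (tensorComponent V 0) := by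
    rw [← span_word b, Submodule.span_le]
    rintro _ ⟨w, rfl⟩
    rw [Submodule.comap_coe, Set.mem_preimage, SetLike.mem_coe]
    rw [tensorComponent_word]
    split_ifs with hw
    · rw [List.length_eq_zero_iff.1 hw, word_nil]
      exact Submodule.one_le.1 le_rfl
    · exact Submodule.zero_mem _
  exact h trivial

theorem tensorComponent_eq_zero (b : Module.Basis (Fin n) ℂ V) {m k : ℕ} (hk : m < k)
    {x : TensorAlgebra ℂ V} (hx : x ∈ tensorLE V m) : tensorComponent V k x = 0 := by
  have h : tensorLE V m ≤ LinearMap.ker (tensorComponent V k) := by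
    rw [tensorLE_eq_span b, Submodule.span_le]
    rintro _ ⟨w, hw, rfl⟩
    change tensorComponent V k (word b w) = 0
    rw [tensorComponent_word, if_neg (by omega)]
  exact h hx

/-- In the top degree i + j only one term of the product formula survives: in any other, one factor
is a component above the degree bound. Taking leading components is thus multiplicative. -/
theorem tensorComponent_mul_of_mem (b : Module.Basis (Fin n) ℂ V) {i j : ℕ}
    {x y : TensorAlgebra ℂ V} (hx : x ∈ tensorLE V i) (hy : y ∈ tensorLE V j) :
    tensorComponent V (i + j) (x * y) = tensorComponent V i x * tensorComponent V j y := by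
  rw [tensorComponent_mul]
  refine Finset.sum_eq_single_of_mem (i, j) (by simp) fun p hp hne => ?_
  have hp' := Finset.HasAntidiagonal.mem_antidiagonal.1 hp
  rcases lt_trichotomy p.1 i with h | h | h
  · rw [tensorComponent_eq_zero b (show j < p.2 by omega) hy, mul_zero]
  · exact absurd (Prod.ext h (by simp only; omega)) hne
  · rw [tensorComponent_eq_zero b h hx, zero_mul]

theorem tensorHomogenize_tensorAction {G : Type*} [Group G] (ρ : Representation ℂ G V) (g : G)
    (x : TensorAlgebra ℂ V) : tensorHomogenize V (tensorAction ρ g x) =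
      Polynomial.mapAlgHom (tensorMap ρ g) (tensorHomogenize V x) := by
  have h : (tensorHomogenize V).comp (tensorMap ρ g) =
      (Polynomial.mapAlgHom (tensorMap ρ g)).comp (tensorHomogenize V) := by
    ext v : 2
    simp [tensorMap_ι, tensorHomogenize_ι]
  exact DFunLike.congr_fun h x

theorem tensorAction_apply {G : Type*} [Group G] (ρ : Representation ℂ G V) (g : G)
    (x : TensorAlgebra ℂ V) : tensorAction ρ g x = tensorMap ρ g x := rfl

theorem tensorComponent_tensorAction {G : Type*} [Group G] (ρ : Representation ℂ G V) (g : G)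
    (k : ℕ) (x : TensorAlgebra ℂ V) : tensorComponent V k (tensorAction ρ g x) =
      tensorAction ρ g (tensorComponent V k x) := by
  change (tensorHomogenize V _).coeff k = _
  rw [tensorHomogenize_tensorAction]
  simp [tensorComponent, coeffX_apply, tensorAction_apply]

end TensorComponents

/-! ### The quantum symmetric algebra, its grading and its relations in low degree. -/

section Symmetric

variable {n : ℕ} {V : Type*} [AddCommGroup V] [Module ℂ V]
  (b : Module.Basis (Fin n) ℂ V) (q : Fin n → Fin n → ℂ)

/-- The quotient map `T(V) → S_q(V)`. -/
def toSymm : TensorAlgebra ℂ V →ₐ[ℂ] QuantumSymmetricAlgebra b q :=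
  RingQuot.mkAlgHom ℂ (CommutationRel b q)

theorem toSymm_surjective : Function.Surjective (toSymm b q) :=
  RingQuot.mkAlgHom_surjective ℂ _

theorem toSymm_ι (v : V) : toSymm b q (TensorAlgebra.ι ℂ v) = CommutationAlgebra.ι b q v := rfl

theorem toSymm_swap (i j : Fin n) :
    toSymm b q (TensorAlgebra.ι ℂ (b i) * TensorAlgebra.ι ℂ (b j)) =
      q i j • toSymm b q (TensorAlgebra.ι ℂ (b j) * TensorAlgebra.ι ℂ (b i)) := by
  rw [← map_smul]
  exact RingQuot.mkAlgHom_rel ℂ (CommutationRel.mk i j)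

theorem toSymm_word_swap (u : List (Fin n)) (i j : Fin n) (v : List (Fin n)) :
    toSymm b q (word b (u ++ i :: j :: v)) = q i j • toSymm b q (word b (u ++ j :: i :: v)) := by
  simp only [word_append, word_cons, ← mul_assoc (TensorAlgebra.ι ℂ (b _)), map_mul _ (word b u)]
  rw [map_mul _ (TensorAlgebra.ι ℂ (b i) * _), toSymm_swap, map_mul _ (TensorAlgebra.ι ℂ (b j) * _),
    smul_mul_assoc, mul_smul_comm]

/-- The quadratic relation `v_i v_j - q_{ij} v_j v_i`. -/
def quadRel (i j : Fin n) : TensorAlgebra ℂ V :=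
  TensorAlgebra.ι ℂ (b i) * TensorAlgebra.ι ℂ (b j)
    - q i j • (TensorAlgebra.ι ℂ (b j) * TensorAlgebra.ι ℂ (b i))

theorem toSymm_quadRel (i j : Fin n) : toSymm b q (quadRel b q i j) = 0 := by
  rw [quadRel, map_sub, map_smul, toSymm_swap, sub_self]

/-- The span of the quadratic relations. -/
def quadRels : Submodule ℂ (TensorAlgebra ℂ V) :=
  Submodule.span ℂ (Set.range fun p : Fin n × Fin n => quadRel b q p.1 p.2)

theorem tensorComponent_quadRel (k : ℕ) (i j : Fin n) :
    tensorComponent V k (quadRel b q i j) = if k = 2 then quadRel b q i j else 0 := by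
  rw [quadRel, map_sub, map_smul, tensorComponent_ι_mul_ι, tensorComponent_ι_mul_ι]
  split_ifs <;> simp

/-- The kernel of `T(V) → S_q(V)` vanishes in degrees `0` and `1` and consists of the quadratic
relations in degree `2`. -/
theorem tensorComponent_of_toSymm_eq_zero {x : TensorAlgebra ℂ V} (hx : toSymm b q x = 0) :
    tensorComponent V 0 x = 0 ∧ tensorComponent V 1 x = 0 ∧
      tensorComponent V 2 x ∈ quadRels b q := by
  -- N is a two-sided ideal: in degrees up to two, a product with an element of N involves only the
  -- constant term of the other factor, which is a scalar.
  let N : Submodule ℂ (TensorAlgebra ℂ V) := LinearMap.ker (tensorComponent V 0) ⊓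
    (LinearMap.ker (tensorComponent V 1) ⊓ (quadRels b q).comap (tensorComponent V 2))
  have hmul : ∀ x y, tensorComponent V 0 (x * y) = tensorComponent V 0 x * tensorComponent V 0 y ∧
      tensorComponent V 1 (x * y) = tensorComponent V 0 x * tensorComponent V 1 y +
        tensorComponent V 1 x * tensorComponent V 0 y ∧
      tensorComponent V 2 (x * y) = tensorComponent V 0 x * tensorComponent V 2 y +
        (tensorComponent V 1 x * tensorComponent V 1 y +
          tensorComponent V 2 x * tensorComponent V 0 y) := by
    intro x y
    simp [tensorComponent_mul, Finset.Nat.antidiagonal_succ]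
  have hN : x - 0 ∈ N := by
    refine sub_mem_of_mkAlgHom_eq (r := CommutationRel b q) N ?_ ?_ ?_
      (hx.trans (map_zero (toSymm b q)).symm)
    · rintro x y ⟨h0, h1, h2⟩
      obtain ⟨e0, e1, e2⟩ := hmul x y
      obtain ⟨c, hc⟩ := Submodule.mem_one.1 (tensorComponent_zero_mem_one b x)
      have h0 : tensorComponent V 0 y = 0 := h0
      have h1 : tensorComponent V 1 y = 0 := h1
      refine ⟨?_, ?_, ?_⟩
      · change tensorComponent V 0 _ = 0
        rw [e0, h0, mul_zero]
      · change tensorComponent V 1 _ = 0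
        rw [e1, h0, h1, mul_zero, mul_zero, add_zero]
      · rw [SetLike.mem_coe, Submodule.mem_comap, e2, h0, h1, mul_zero, mul_zero, add_zero, add_zero, ← hc, ← Algebra.smul_def]
        exact Submodule.smul_mem _ _ h2
    · rintro y x ⟨h0, h1, h2⟩
      obtain ⟨e0, e1, e2⟩ := hmul y x
      obtain ⟨c, hc⟩ := Submodule.mem_one.1 (tensorComponent_zero_mem_one b x)
      have h0 : tensorComponent V 0 y = 0 := h0
      have h1 : tensorComponent V 1 y = 0 := h1
      refine ⟨?_, ?_, ?_⟩
      · change tensorComponent V 0 _ = 0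
        rw [e0, h0, zero_mul]
      · change tensorComponent V 1 _ = 0
        rw [e1, h0, h1, zero_mul, zero_mul, add_zero]
      · rw [SetLike.mem_coe, Submodule.mem_comap, e2, h0, h1, zero_mul, zero_mul, zero_add, zero_add, ← hc, ← Algebra.commutes,
          ← Algebra.smul_def]
        exact Submodule.smul_mem _ _ h2
    · rintro _ _ ⟨i, j⟩
      change quadRel b q i j ∈ N
      refine ⟨?_, ?_, ?_⟩
      · change tensorComponent V 0 _ = 0
        rw [tensorComponent_quadRel, if_neg (by norm_num)]
      · change tensorComponent V 1 _ = 0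
        rw [tensorComponent_quadRel, if_neg (by norm_num)]
      · rw [SetLike.mem_coe, Submodule.mem_comap, tensorComponent_quadRel, if_pos rfl]
        exact Submodule.subset_span ⟨(i, j), rfl⟩
  rw [sub_zero] at hN
  exact ⟨hN.1, hN.2.1, hN.2.2⟩

/-- The relations begin in degree two, so the constant term of 1 survives. This is what embeds ℂ^α G
in S_q(V) #_α G. -/
instance : Nontrivial (QuantumSymmetricAlgebra b q) := by
  refine ⟨⟨1, 0, fun h => ?_⟩⟩
  have := (tensorComponent_of_toSymm_eq_zero b q (x := 1) (by rw [map_one, h])).1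
  rw [tensorComponent_one, if_pos rfl] at this
  exact one_ne_zero this

theorem mem_quadRels_of_toSymm_eq_zero {x : TensorAlgebra ℂ V} (hx : toSymm b q x = 0)
    (hx2 : tensorComponent V 2 x = x) : x ∈ quadRels b q :=
  hx2 ▸ (tensorComponent_of_toSymm_eq_zero b q hx).2.2

/-- The homomorphism `S_q(V) → S_q(V)[X]` that multiplies each vector by `X`. -/
def symmHomogenize :
    QuantumSymmetricAlgebra b q →ₐ[ℂ] Polynomial (QuantumSymmetricAlgebra b q) :=
  RingQuot.liftAlgHom ℂ ⟨(Polynomial.mapAlgHom (toSymm b q)).comp (tensorHomogenize V), by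
    rintro _ _ ⟨i, j⟩
    simp only [AlgHom.comp_apply, map_mul, map_smul, tensorHomogenize_ι,
      Polynomial.monomial_mul_monomial, Polynomial.coe_mapAlgHom, Polynomial.map_monomial,
      RingHom.coe_coe]
    rw [← map_mul, toSymm_swap, Polynomial.smul_monomial, map_mul]⟩

theorem symmHomogenize_toSymm (x : TensorAlgebra ℂ V) : symmHomogenize b q (toSymm b q x) =
    Polynomial.mapAlgHom (toSymm b q) (tensorHomogenize V x) :=
  RingQuot.liftAlgHom_mkAlgHom_apply _ _ _ _

/-- The projection of `S_q(V)` onto its homogeneous component of degree `k`. -/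
def symmComponent (k : ℕ) : QuantumSymmetricAlgebra b q →ₗ[ℂ] QuantumSymmetricAlgebra b q :=
  coeffX _ k ∘ₗ (symmHomogenize b q).toLinearMap

theorem symmComponent_toSymm (k : ℕ) (x : TensorAlgebra ℂ V) :
    symmComponent b q k (toSymm b q x) = toSymm b q (tensorComponent V k x) := by
  change (symmHomogenize b q (toSymm b q x)).coeff k = toSymm b q ((tensorHomogenize V x).coeff k)
  rw [symmHomogenize_toSymm]
  simp

variable {b q}

theorem toSymm_tensorAction {G : Type*} [Group G] {ρ : Representation ℂ G V}
    {φ : G →* (QuantumSymmetricAlgebra b q ≃ₐ[ℂ] QuantumSymmetricAlgebra b q)}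
    (hφ : ExtendsAction ρ b q φ) (g : G) (x : TensorAlgebra ℂ V) :
    toSymm b q (tensorAction ρ g x) = φ g (toSymm b q x) := by
  have h : (toSymm b q).comp (tensorMap ρ g) = (φ g).toAlgHom.comp (toSymm b q) := by
    ext v
    simp only [LinearMap.comp_apply, AlgHom.toLinearMap_apply, AlgHom.comp_apply, tensorMap_ι,
      toSymm_ι]
    exact (hφ g v).symm
  exact DFunLike.congr_fun h x

end Symmetric

/-! ### The skew group algebras of T(V) and S_q(V). -/

section Skew

variable {G : Type*} [Group G] {n : ℕ} {V : Type*} [AddCommGroup V] [Module ℂ V]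
  {b : Module.Basis (Fin n) ℂ V} {ρ : Representation ℂ G V} {q : Fin n → Fin n → ℂ}
  (α : NormalizedTwoCocycle G)
  {φ : G →* (QuantumSymmetricAlgebra b q ≃ₐ[ℂ] QuantumSymmetricAlgebra b q)}
  (hφ : ExtendsAction ρ b q φ)

/-- The quotient map `T(V) #_α G → S_q(V) #_α G`. -/
def toSkew : TwistedSkewGroupAlgebra (tensorAction ρ) α →ₐ[ℂ] TwistedSkewGroupAlgebra φ α :=
  TwistedSkewGroupAlgebra.map (toSymm b q) (toSymm_tensorAction hφ)

/-- The projection of `T(V) #_α G` onto its homogeneous component of degree `k`. -/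
def tensorSkewComponent (ρ : Representation ℂ G V) (k : ℕ) :
    TwistedSkewGroupAlgebra (tensorAction ρ) α →ₗ[ℂ] TwistedSkewGroupAlgebra (tensorAction ρ) α :=
  mapCoeffs _ _ α (tensorComponent V k)

/-- The projection of `S_q(V) #_α G` onto its homogeneous component of degree `k`. -/
def skewComponent (φ : G →* (QuantumSymmetricAlgebra b q ≃ₐ[ℂ] QuantumSymmetricAlgebra b q))
    (k : ℕ) : TwistedSkewGroupAlgebra φ α →ₗ[ℂ] TwistedSkewGroupAlgebra φ α :=
  mapCoeffs _ _ α (symmComponent b q k)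

/-- The elements of `T(V) #_α G` of degree at most `m`. -/
abbrev skewLE (ρ : Representation ℂ G V) (m : ℕ) :
    Submodule ℂ (TwistedSkewGroupAlgebra (tensorAction ρ) α) :=
  coeffsIn (tensorAction ρ) α (tensorLE V m)

variable {α}

theorem toSkew_single (g : G) (x : TensorAlgebra ℂ V) :
    toSkew α hφ (single _ α g x) = single φ α g (toSymm b q x) :=
  map_single _ _ _ _

theorem toSkew_surjective [Finite G] : Function.Surjective (toSkew α hφ) := by
  intro y
  choose f hf using fun g => toSymm_surjective b q (coeff φ α g y)
  exact ⟨(toFinsupp _ α).symm (Finsupp.equivFunOnFinite.symm f), ext_coeff hf⟩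

theorem skewComponent_toSkew (k : ℕ) (x : TwistedSkewGroupAlgebra (tensorAction ρ) α) :
    skewComponent α φ k (toSkew α hφ x) = toSkew α hφ (tensorSkewComponent α ρ k x) :=
  ext_coeff fun _ => symmComponent_toSymm b q k _

theorem skewLE_mono {i j : ℕ} (h : i ≤ j) : skewLE α ρ i ≤ skewLE α ρ j := fun _ hx =>
  mem_coeffsIn.2 fun g => tensorLE_mono h (mem_coeffsIn.1 hx g)

theorem mul_mem_skewLE {i j : ℕ} {x y : TwistedSkewGroupAlgebra (tensorAction ρ) α}
    (hx : x ∈ skewLE α ρ i) (hy : y ∈ skewLE α ρ j) : x * y ∈ skewLE α ρ (i + j) := by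
  refine mul_mem_coeffsIn (fun g c d hc hd => ?_) hx hy
  rw [tensorLE, pow_add]
  exact Submodule.mul_mem_mul hc (tensorAction_mem_tensorLE ρ g hd)

theorem tensorLE_zero (V : Type*) [AddCommGroup V] [Module ℂ V] : tensorLE V 0 = 1 := pow_zero _

theorem groupInclusion_mem_skewLE (k : TwistedGroupAlgebra α) :
    groupInclusion (tensorAction ρ) α k ∈ skewLE α ρ 0 := by
  rw [skewLE, tensorLE_zero]
  exact groupInclusion_mem k

theorem single_word_mem_skewLE (g : G) {w : List (Fin n)} {m : ℕ} (hw : w.length ≤ m) :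
    single _ α g (word b w) ∈ skewLE α ρ m :=
  single_mem_coeffsIn g (word_mem_tensorLE b hw)

theorem single_one_mem_skewLE (g : G) : single _ α g 1 ∈ skewLE α ρ 0 := by
  refine single_mem_coeffsIn g ?_
  rw [tensorLE_zero]
  exact Submodule.one_le.1 le_rfl

/-- `T(V) #_α G` in degree at most `m` is spanned by the elements `w t_g` for words `w`. -/
theorem skewLE_le (b : Module.Basis (Fin n) ℂ V) {m : ℕ} {N : Submodule ℂ (TwistedSkewGroupAlgebra (tensorAction ρ) α)}
    (h : ∀ g w, w.length ≤ m → single _ α g (word b w) ∈ N) : skewLE α ρ m ≤ N := by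
  refine coeffsIn_le fun g => ?_
  rw [tensorLE_eq_span b, Submodule.span_le]
  rintro _ ⟨w, hw, rfl⟩
  exact h g w hw

theorem top_le_of_single_word_mem (b : Module.Basis (Fin n) ℂ V) {N : Submodule ℂ (TwistedSkewGroupAlgebra (tensorAction ρ) α)}
    (h : ∀ g w, single _ α g (word b w) ∈ N) : ⊤ ≤ N := by
  refine le_trans (fun x _ => ?_) (coeffsIn_le (W := ⊤) fun g => ?_)
  · exact mem_coeffsIn.2 fun _ => trivial
  · rw [← span_word b, Submodule.span_le]
    rintro _ ⟨w, rfl⟩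
    exact h g w

theorem exists_mem_skewLE (b : Module.Basis (Fin n) ℂ V) (x : TwistedSkewGroupAlgebra (tensorAction ρ) α) :
    ∃ m, x ∈ skewLE α ρ m := by
  let N : Submodule ℂ (TwistedSkewGroupAlgebra (tensorAction ρ) α) := ⨆ m, skewLE α ρ m
  have hN : x ∈ N := top_le_of_single_word_mem b
    (fun g w => Submodule.mem_iSup_of_mem w.length (single_word_mem_skewLE g le_rfl)) trivial
  exact (Submodule.mem_iSup_of_directed _
    (Monotone.directed_le fun i j h => skewLE_mono h)).1 hN

theorem tensorSkewComponent_eq_zero (b : Module.Basis (Fin n) ℂ V) {m k : ℕ} (hk : m < k)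
    {x : TwistedSkewGroupAlgebra (tensorAction ρ) α} (hx : x ∈ skewLE α ρ m) :
    tensorSkewComponent α ρ k x = 0 :=
  ext_coeff fun g => tensorComponent_eq_zero b hk (mem_coeffsIn.1 hx g)

/-- By linearity it suffices to treat c t_g and d t_h, where the formula in T(V) applies because g
preserves degrees. The multiplicativity of the map on the associated graded algebra rests on this.
-/
theorem tensorSkewComponent_mul (b : Module.Basis (Fin n) ℂ V) {i j : ℕ} {x y : TwistedSkewGroupAlgebra (tensorAction ρ) α}
    (hx : x ∈ skewLE α ρ i) (hy : y ∈ skewLE α ρ j) :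
    tensorSkewComponent α ρ (i + j) (x * y) =
      tensorSkewComponent α ρ i x * tensorSkewComponent α ρ j y := by
  have key : ∀ g h : G, ∀ c ∈ tensorLE V i, ∀ d ∈ tensorLE V j,
      tensorSkewComponent α ρ (i + j) (single _ α g c * single _ α h d) =
      tensorSkewComponent α ρ i (single _ α g c) * tensorSkewComponent α ρ j (single _ α h d) := by
    intro g h c hc d hd
    simp only [tensorSkewComponent, single_mul_single, mapCoeffs_single, map_smul]
    rw [tensorComponent_mul_of_mem b hc (tensorAction_mem_tensorLE ρ g hd),
      tensorComponent_tensorAction]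
  have h1 : ∀ g : G, ∀ c ∈ tensorLE V i, skewLE α ρ j ≤ LinearMap.ker
      (tensorSkewComponent α ρ (i + j) ∘ₗ LinearMap.mulLeft ℂ (single _ α g c) -
        LinearMap.mulLeft ℂ (tensorSkewComponent α ρ i (single _ α g c)) ∘ₗ
          tensorSkewComponent α ρ j) := by
    intro g c hc
    refine coeffsIn_le fun h d hd => ?_
    simpa [sub_eq_zero] using key g h c hc d hd
  have h2 : skewLE α ρ i ≤ LinearMap.ker
      (tensorSkewComponent α ρ (i + j) ∘ₗ LinearMap.mulRight ℂ y -
        LinearMap.mulRight ℂ (tensorSkewComponent α ρ j y) ∘ₗ tensorSkewComponent α ρ i) := by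
    refine coeffsIn_le fun g c hc => ?_
    simpa [sub_eq_zero] using h1 g c hc hy
  simpa [sub_eq_zero] using h2 hx

/-- The kernel of T(V) → S_q(V) has no part of degree zero, so identities in degree zero may be
checked in S_q(V) #_α G, where the cocycle lives. -/
theorem eq_zero_of_toSkew_eq_zero_of_mem_one {x : TwistedSkewGroupAlgebra (tensorAction ρ) α}
    (hx : x ∈ skewLE α ρ 0) (h : toSkew α hφ x = 0) : x = 0 := by
  refine ext_coeff fun g => ?_
  have h1 := (tensorComponent_of_toSymm_eq_zero b q (x := coeff _ α g x)
    (congrArg (coeff φ α g) h)).1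
  rw [skewLE, tensorLE_zero] at hx
  rwa [tensorComponent_of_mem_one (mem_coeffsIn.1 hx g), if_pos rfl] at h1

/-- The kernel has no part of degree one either; the Jacobi identity is transported in this way. -/
theorem eq_zero_of_toSkew_eq_zero_of_mem_range {x : TwistedSkewGroupAlgebra (tensorAction ρ) α}
    (hx : x ∈ coeffsIn (tensorAction ρ) α (LinearMap.range (TensorAlgebra.ι ℂ)))
    (h : toSkew α hφ x = 0) : x = 0 := by
  refine ext_coeff fun g => ?_
  have h1 := (tensorComponent_of_toSymm_eq_zero b q (x := coeff _ α g x)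
    (congrArg (coeff φ α g) h)).2.1
  obtain ⟨v, hv⟩ := mem_coeffsIn.1 hx g
  rw [← hv, tensorComponent_ι, if_pos rfl] at h1
  rw [← hv, h1, map_zero]

end Skew

/-! ### The PBW conditions on κ. -/

section Relations

variable {G : Type*} [Group G] {n : ℕ} {V : Type*} [AddCommGroup V] [Module ℂ V]
  (b : Module.Basis (Fin n) ℂ V) (ρ : Representation ℂ G V) (q : Fin n → Fin n → ℂ)
  {α : NormalizedTwoCocycle G} (κ : V →ₗ[ℂ] V →ₗ[ℂ] TwistedGroupAlgebra α)

/-- The element `κ(v_i, v_j)` of `T(V) #_α G`. -/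
def kappaT (i j : Fin n) : TwistedSkewGroupAlgebra (tensorAction ρ) α :=
  groupInclusion (tensorAction ρ) α (κ (b i) (b j))

/-- The relation `v_i v_j - q_{ij} v_j v_i - κ(v_i, v_j)` in `T(V) #_α G`. -/
def heckeRel (i j : Fin n) : TwistedSkewGroupAlgebra (tensorAction ρ) α :=
  single _ α 1 (quadRel b q i j) - kappaT b ρ κ i j

/-- The span of the relations `v_i v_j - q_{ij} v_j v_i - κ(v_i, v_j)`. -/
def heckeRels : Submodule ℂ (TwistedSkewGroupAlgebra (tensorAction ρ) α) :=
  Submodule.span ℂ (Set.range fun p : Fin n × Fin n => heckeRel b ρ q κ p.1 p.2)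

/-- The vector `v_i`, as an element of `T(V) #_α G`. -/
def vecT (α : NormalizedTwoCocycle G) (i : Fin n) : TwistedSkewGroupAlgebra (tensorAction ρ) α :=
  single _ α 1 (TensorAlgebra.ι ℂ (b i))

/-- The conditions on `κ` under which `H_{q,κ,α}` satisfies the PBW property: `κ` is quantum
skew-symmetric, compatible with the action of `G`, and satisfies a quantum Jacobi identity. -/
structure PBWConditions : Prop where
  skew : ∀ i j, κ (b i) (b j) = -(q i j • κ (b j) (b i))
  -- In this form t_g can be moved to the right across a relation, so that only relations between
  -- words have to be considered.
  equivariant : ∀ (g : G) (i j : Fin n), ∃ e ∈ heckeRels b ρ q κ,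
    single _ α g 1 * heckeRel b ρ q κ i j = e * single _ α g 1
  -- The two sides collect the corrections from the two ways of reversing v_i v_j v_k by adjacent
  -- swaps.
  jacobi : ∀ i j k : Fin n,
    kappaT b ρ κ i j * vecT b ρ α k + q i j • (vecT b ρ α j * kappaT b ρ κ i k) +
        (q i j * q i k) • (kappaT b ρ κ j k * vecT b ρ α i) =
      vecT b ρ α i * kappaT b ρ κ j k + q j k • (kappaT b ρ κ i k * vecT b ρ α j) +
        (q j k * q i k) • (vecT b ρ α k * kappaT b ρ κ i j)

end Relations

/-! ### From the constant cocycle to the PBW conditions. -/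

section Cocycle

variable {G : Type*} [Group G] {n : ℕ} {V : Type*} [AddCommGroup V] [Module ℂ V]
  {b : Module.Basis (Fin n) ℂ V} {ρ : Representation ℂ G V} {q : Fin n → Fin n → ℂ}
  {α : NormalizedTwoCocycle G}
  {φ : G →* (QuantumSymmetricAlgebra b q ≃ₐ[ℂ] QuantumSymmetricAlgebra b q)}

/-- A vector, as an element of `S_q(V) #_α G`. -/
def vecS (α : NormalizedTwoCocycle G)
    (φ : G →* (QuantumSymmetricAlgebra b q ≃ₐ[ℂ] QuantumSymmetricAlgebra b q)) :
    V →ₗ[ℂ] TwistedSkewGroupAlgebra φ α :=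
  single φ α 1 ∘ₗ CommutationAlgebra.ι b q

theorem vecS_apply (v : V) : vecS α φ v = single φ α 1 (CommutationAlgebra.ι b q v) := rfl

theorem vecS_mem (v : V) : vecS α φ v ∈ coeffsIn φ α (CommutationAlgebra.piece b q 1) := by
  refine single_mem_coeffsIn _ ?_
  rw [CommutationAlgebra.piece, pow_one]
  exact ⟨v, rfl⟩

theorem piece_zero : CommutationAlgebra.piece b q 0 = 1 := pow_zero _

theorem single_one_mem (g : G) :
    single φ α g 1 ∈ coeffsIn φ α (CommutationAlgebra.piece b q 0) := by
  refine single_mem_coeffsIn _ ?_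
  rw [piece_zero]
  exact Submodule.one_le.1 le_rfl

variable (b q) in
theorem vecS_mul_vecS (i j : Fin n) :
    vecS α φ (b i) * vecS α φ (b j) = q i j • (vecS α φ (b j) * vecS α φ (b i)) := by
  simp only [vecS_apply, single_one_mul_single_one, ← toSymm_ι, ← map_mul]
  rw [toSymm_swap, map_smul]

theorem single_mul_vecS (hφ : ExtendsAction ρ b q φ) (g : G) (v : V) :
    single φ α g 1 * vecS α φ v = vecS α φ (ρ g v) * single φ α g 1 := by
  rw [vecS_apply, single_one_swap, hφ, vecS_apply]

variable {μ : TwistedSkewGroupAlgebra φ α →ₗ[ℂ] TwistedSkewGroupAlgebra φ α →ₗ[ℂ]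
  TwistedSkewGroupAlgebra φ α}

/-- The value would have degree 1 + 0 - 2 < 0. -/
theorem IsConstant.vecS_single (hμc : IsConstant μ) (v : V) (g : G) :
    μ (vecS α φ v) (single φ α g 1) = 0 :=
  (hμc 1 0 _ _ (vecS_mem v) (single_one_mem g)).1 (by norm_num)

theorem IsConstant.single_vecS (hμc : IsConstant μ) (v : V) (g : G) :
    μ (single φ α g 1) (vecS α φ v) = 0 :=
  (hμc 0 1 _ _ (single_one_mem g) (vecS_mem v)).1 (by norm_num)

theorem IsConstant.vecS_vecS_mem (hμc : IsConstant μ) (v w : V) :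
    μ (vecS α φ v) (vecS α φ w) ∈ coeffsIn φ α 1 := by
  rw [← piece_zero (b := b) (q := q)]
  exact (hμc 1 1 _ _ (vecS_mem v) (vecS_mem w)).2 0 rfl

/-- A constant cocycle satisfies `t_g μ(v, w) + μ(t_g, v w) = μ(ᵍv ᵍw, t_g) + μ(ᵍv, ᵍw) t_g`. -/
theorem single_mul_cocycle (hφ : ExtendsAction ρ b q φ) (hμ : IsHochschildTwoCocycle μ)
    (hμc : IsConstant μ) (g : G) (v w : V) :
    single φ α g 1 * μ (vecS α φ v) (vecS α φ w) + μ (single φ α g 1) (vecS α φ v * vecS α φ w) =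
      μ (vecS α φ (ρ g v) * vecS α φ (ρ g w)) (single φ α g 1) +
        μ (vecS α φ (ρ g v)) (vecS α φ (ρ g w)) * single φ α g 1 := by
  -- The group element passes from left to right through the two vectors, one cocycle identity for
  -- each position. The values of μ on a vector and t_g vanish, and the remaining terms telescope.
  have h1 := hμ (single φ α g 1) (vecS α φ v) (vecS α φ w)
  have h2 := hμ (vecS α φ (ρ g v)) (single φ α g 1) (vecS α φ w)
  have h3 := hμ (vecS α φ (ρ g v)) (vecS α φ (ρ g w)) (single φ α g 1)
  rw [hμc.single_vecS, zero_mul, add_zero, single_mul_vecS hφ] at h1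
  rw [hμc.single_vecS, hμc.vecS_single, mul_zero, zero_mul, zero_add, add_zero,
    single_mul_vecS hφ] at h2
  rw [hμc.vecS_single, mul_zero, zero_add] at h3
  rw [h1, ← h2, h3]

/-- The linear extension of `v_i ⊗ v_j ↦ μ(v_i, v_j)` to `T(V)`. -/
def cocycleOnTensors (μ : TwistedSkewGroupAlgebra φ α →ₗ[ℂ] TwistedSkewGroupAlgebra φ α →ₗ[ℂ]
    TwistedSkewGroupAlgebra φ α) : TensorAlgebra ℂ V →ₗ[ℂ] TwistedSkewGroupAlgebra φ α :=
  b.tensorAlgebra.constr ℂ fun w =>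
    match w.toList with
    | [i, j] => μ (vecS α φ (b i)) (vecS α φ (b j))
    -- A filler: the map is only evaluated on tensors of degree two.
    | _ => 0

theorem cocycleOnTensors_ι_mul_ι (v w : V) :
    cocycleOnTensors μ (TensorAlgebra.ι ℂ v * TensorAlgebra.ι ℂ w) =
      μ (vecS α φ v) (vecS α φ w) := by
  have h : ((LinearMap.mul ℂ (TensorAlgebra ℂ V)).compl₁₂ (TensorAlgebra.ι ℂ)
      (TensorAlgebra.ι ℂ)).compr₂ (cocycleOnTensors μ) =
        μ.compl₁₂ (vecS α φ) (vecS α φ) := by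
    refine b.ext fun i => b.ext fun j => ?_
    change cocycleOnTensors μ (TensorAlgebra.ι ℂ (b i) * TensorAlgebra.ι ℂ (b j)) = _
    rw [← word_singleton, ← word_singleton, ← word_append, ← tensorAlgebra_basis_apply,
      cocycleOnTensors, Module.Basis.constr_basis]
    rfl
  exact LinearMap.congr_fun₂ h v w

/-- In the difference of `single_mul_cocycle` for (v_i, v_j) and q_{ij} times the same identity for
(v_j, v_i), the terms with t_g as an argument of μ cancel: v_i v_j = q_{ij} v_j v_i in S_q(V), and
the automorphism given by g preserves this relation. -/
theorem single_mul_cocycleOnTensors (hφ : ExtendsAction ρ b q φ) (hμ : IsHochschildTwoCocycle μ)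
    (hμc : IsConstant μ) (g : G) (i j : Fin n) :
    single φ α g 1 * cocycleOnTensors μ (quadRel b q i j) =
      cocycleOnTensors μ (tensorAction ρ g (quadRel b q i j)) * single φ α g 1 := by
  have h1 := single_mul_cocycle hφ hμ hμc g (b i) (b j)
  have h2 := single_mul_cocycle hφ hμ hμc g (b j) (b i)
  have h3 : vecS α φ (ρ g (b i)) * vecS α φ (ρ g (b j)) =
      q i j • (vecS α φ (ρ g (b j)) * vecS α φ (ρ g (b i))) := by
    simp only [vecS_apply, single_one_mul_single_one, ← hφ g, ← map_mul]
    rw [← toSymm_ι, ← toSymm_ι, ← map_mul, toSymm_swap, map_smul, map_smul, map_mul]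
  have h4 : μ (single φ α g 1) (vecS α φ (b i) * vecS α φ (b j)) =
      q i j • μ (single φ α g 1) (vecS α φ (b j) * vecS α φ (b i)) := by
    rw [vecS_mul_vecS, map_smul]
  have h5 : μ (vecS α φ (ρ g (b i)) * vecS α φ (ρ g (b j))) (single φ α g 1) =
      q i j • μ (vecS α φ (ρ g (b j)) * vecS α φ (ρ g (b i))) (single φ α g 1) := by
    rw [h3, map_smul, LinearMap.smul_apply]
  simp only [quadRel, map_sub, map_smul, map_mul, tensorAction_apply, tensorMap_ι,
    cocycleOnTensors_ι_mul_ι, mul_sub, sub_mul, mul_smul_comm, smul_mul_assoc]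
  rw [h4, h5] at h1
  linear_combination (norm := module) h1 - q i j • h2

variable {κ : V →ₗ[ℂ] V →ₗ[ℂ] TwistedGroupAlgebra α}

theorem IsQuantumSkewSymmetrization.toSkew_kappaT (hφ : ExtendsAction ρ b q φ)
    (hκ : IsQuantumSkewSymmetrization κ μ) (i j : Fin n) :
    toSkew α hφ (kappaT b ρ κ i j) = cocycleOnTensors μ (quadRel b q i j) := by
  rw [kappaT, toSkew, map_groupInclusion, hκ, quadRel, map_sub, map_smul,
    cocycleOnTensors_ι_mul_ι, cocycleOnTensors_ι_mul_ι]
  rfl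

theorem IsQuantumSkewSymmetrization.skew (hq : IsQuantumParameter q)
    (hκ : IsQuantumSkewSymmetrization κ μ) (i j : Fin n) :
    κ (b i) (b j) = -(q i j • κ (b j) (b i)) := by
  apply groupInclusion_injective (φ := φ)
  rw [map_neg, map_smul, hκ, hκ, smul_sub, smul_smul, hq.inv i j,
    mul_inv_cancel₀ (hq.ne_zero i j), one_smul, neg_sub]

/-- Every quadratic relation lifts to a relation of `H_{q,κ,α}`. -/
theorem IsQuantumSkewSymmetrization.exists_lift (hφ : ExtendsAction ρ b q φ)
    (hκ : IsQuantumSkewSymmetrization κ μ) {z : TensorAlgebra ℂ V} (hz : z ∈ quadRels b q) :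
    ∃ k ∈ skewLE α ρ 0, single _ α 1 z - k ∈ heckeRels b ρ q κ ∧
      toSkew α hφ k = cocycleOnTensors μ z := by
  induction hz using Submodule.span_induction with
  | mem z hz =>
    obtain ⟨⟨i, j⟩, rfl⟩ := hz
    exact ⟨kappaT b ρ κ i j, groupInclusion_mem_skewLE _, Submodule.subset_span ⟨(i, j), rfl⟩,
      hκ.toSkew_kappaT hφ i j⟩
  | zero => exact ⟨0, Submodule.zero_mem _, by simp, by simp⟩
  | add x y _ _ hx hy =>
    obtain ⟨k, hk, hk1, hk2⟩ := hx
    obtain ⟨l, hl, hl1, hl2⟩ := hy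
    refine ⟨k + l, Submodule.add_mem _ hk hl, ?_, by rw [map_add, map_add, hk2, hl2]⟩
    rw [map_add, add_sub_add_comm]
    exact Submodule.add_mem _ hk1 hl1
  | smul c x _ hx =>
    obtain ⟨k, hk, hk1, hk2⟩ := hx
    refine ⟨c • k, Submodule.smul_mem _ c hk, ?_, by rw [map_smul, map_smul, hk2]⟩
    rw [map_smul, ← smul_sub]
    exact Submodule.smul_mem _ c hk1

/-- The image of a quadratic relation under g has degree two and vanishes in S_q(V), so it is a
combination of quadratic relations. `IsQuantumSkewSymmetrization.exists_lift` supplies its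
correction k of degree zero. That k t_g equals t_g κ(v_i, v_j) may be checked in S_q(V) #_α G, where
it is the cocycle identity. -/
theorem IsQuantumSkewSymmetrization.equivariant (hφ : ExtendsAction ρ b q φ)
    (hμ : IsHochschildTwoCocycle μ) (hμc : IsConstant μ)
    (hκ : IsQuantumSkewSymmetrization κ μ) (g : G) (i j : Fin n) :
    ∃ e ∈ heckeRels b ρ q κ, single _ α g 1 * heckeRel b ρ q κ i j = e * single _ α g 1 := by
  have hz : tensorAction ρ g (quadRel b q i j) ∈ quadRels b q := by
    refine mem_quadRels_of_toSymm_eq_zero b q ?_ ?_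
    · rw [toSymm_tensorAction hφ, toSymm_quadRel, map_zero]
    · rw [tensorComponent_tensorAction, tensorComponent_quadRel, if_pos rfl]
  obtain ⟨k, hk, hk1, hk2⟩ := hκ.exists_lift hφ hz
  refine ⟨_, hk1, ?_⟩
  have h0 : k * single _ α g 1 - single _ α g 1 * kappaT b ρ κ i j = 0 := by
    have h1 := mul_mem_skewLE hk (single_one_mem_skewLE g)
    have h2 := mul_mem_skewLE (single_one_mem_skewLE g)
      (groupInclusion_mem_skewLE (ρ := ρ) (κ (b i) (b j)))
    rw [add_zero] at h1 h2
    refine eq_zero_of_toSkew_eq_zero_of_mem_one hφ (Submodule.sub_mem _ h1 h2) ?_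
    rw [map_sub, map_mul, map_mul, hk2, hκ.toSkew_kappaT, toSkew_single, map_one,
      single_mul_cocycleOnTensors hφ hμ hμc, sub_self]
  rw [heckeRel, mul_sub, sub_mul, single_one_swap, sub_eq_zero.1 h0]

/-- The cocycle condition on the two expressions of `v_i v_j v_k - q_{ij} q_{ik} q_{jk} v_k v_j v_i`
as a combination of quadratic relations. -/
theorem cocycle_jacobi (hμ : IsHochschildTwoCocycle μ) (i j k : Fin n) :
    cocycleOnTensors μ (quadRel b q i j) * vecS α φ (b k) +
        q i j • (vecS α φ (b j) * cocycleOnTensors μ (quadRel b q i k)) +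
        (q i j * q i k) • (cocycleOnTensors μ (quadRel b q j k) * vecS α φ (b i)) =
      vecS α φ (b i) * cocycleOnTensors μ (quadRel b q j k) +
        q j k • (cocycleOnTensors μ (quadRel b q i k) * vecS α φ (b j)) +
        (q j k * q i k) • (vecS α φ (b k) * cocycleOnTensors μ (quadRel b q i j)) := by
  have hl : ∀ i j k : Fin n, μ (vecS α φ (b i) * vecS α φ (b j)) (vecS α φ (b k)) =
      q i j • μ (vecS α φ (b j) * vecS α φ (b i)) (vecS α φ (b k)) := fun i j k => by
    rw [vecS_mul_vecS, map_smul, LinearMap.smul_apply]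
  have hr : ∀ i j k : Fin n, μ (vecS α φ (b k)) (vecS α φ (b i) * vecS α φ (b j)) =
      q i j • μ (vecS α φ (b k)) (vecS α φ (b j) * vecS α φ (b i)) := fun i j k => by
    rw [vecS_mul_vecS, map_smul]
  -- One cocycle identity for each of the six orderings. Terms where μ has a product of two vectors
  -- as an argument agree in pairs of adjacent orderings, up to a factor q.
  have h1 := hμ (vecS α φ (b i)) (vecS α φ (b j)) (vecS α φ (b k))
  have h2 := hμ (vecS α φ (b j)) (vecS α φ (b i)) (vecS α φ (b k))
  have h3 := hμ (vecS α φ (b j)) (vecS α φ (b k)) (vecS α φ (b i))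
  have h4 := hμ (vecS α φ (b k)) (vecS α φ (b j)) (vecS α φ (b i))
  have h5 := hμ (vecS α φ (b i)) (vecS α φ (b k)) (vecS α φ (b j))
  have h6 := hμ (vecS α φ (b k)) (vecS α φ (b i)) (vecS α φ (b j))
  rw [hl i j k, hr j k i] at h1
  rw [hr i k j] at h2
  rw [hl j k i] at h3
  rw [hl i k j] at h5
  rw [hr i j k] at h6
  simp only [quadRel, map_sub, map_smul, cocycleOnTensors_ι_mul_ι, mul_sub, sub_mul,
    mul_smul_comm, smul_mul_assoc]
  -- Each ordering is weighted by the factor that carries v_i v_j v_k to it in S_q(V), with minus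
  -- the sign of the permutation.
  linear_combination (norm := module) -h1 + q i j • h2 - (q i j * q i k) • h3 +
    (q i j * q i k * q j k) • h4 + q j k • h5 - (q j k * q i k) • h6

theorem vecT_mem_range (i : Fin n) :
    vecT b ρ α i ∈ coeffsIn (tensorAction ρ) α (LinearMap.range (TensorAlgebra.ι ℂ)) :=
  single_mem_coeffsIn 1 ⟨b i, rfl⟩

theorem mul_vecT_mem_range {k : TwistedSkewGroupAlgebra (tensorAction ρ) α}
    (hk : k ∈ coeffsIn (tensorAction ρ) α 1) (i : Fin n) :
    k * vecT b ρ α i ∈ coeffsIn (tensorAction ρ) α (LinearMap.range (TensorAlgebra.ι ℂ)) := by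
  refine mul_mem_coeffsIn (fun g c d hc hd => ?_) hk (vecT_mem_range i)
  obtain ⟨c, rfl⟩ := Submodule.mem_one.1 hc
  obtain ⟨v, rfl⟩ := hd
  rw [← Algebra.smul_def, tensorAction_apply, tensorMap_ι, ← map_smul]
  exact ⟨_, rfl⟩

theorem vecT_mul_mem_range {k : TwistedSkewGroupAlgebra (tensorAction ρ) α}
    (hk : k ∈ coeffsIn (tensorAction ρ) α 1) (i : Fin n) :
    vecT b ρ α i * k ∈ coeffsIn (tensorAction ρ) α (LinearMap.range (TensorAlgebra.ι ℂ)) := by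
  refine mul_mem_coeffsIn (fun g c d hc hd => ?_) (vecT_mem_range i) hk
  obtain ⟨c', rfl⟩ := Submodule.mem_one.1 hd
  obtain ⟨v, rfl⟩ := hc
  rw [AlgEquiv.commutes, ← Algebra.commutes, ← Algebra.smul_def, ← map_smul]
  exact ⟨_, rfl⟩

theorem toSkew_vecT (hφ : ExtendsAction ρ b q φ) (i : Fin n) :
    toSkew α hφ (vecT b ρ α i) = vecS α φ (b i) := by
  rw [vecT, toSkew_single, toSymm_ι, vecS_apply]

/-- The quantum skew-symmetrization of a constant Hochschild `2`-cocycle satisfies the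
PBW conditions. -/
theorem IsQuantumSkewSymmetrization.pbwConditions (hq : IsQuantumParameter q)
    (hφ : ExtendsAction ρ b q φ) (hμ : IsHochschildTwoCocycle μ) (hμc : IsConstant μ)
    (hκ : IsQuantumSkewSymmetrization κ μ) : PBWConditions b ρ q κ where
  skew := hκ.skew hq
  equivariant := hκ.equivariant hφ hμ hμc
  jacobi i j k := by
    have hmem : ∀ i j, kappaT b ρ κ i j ∈ coeffsIn (tensorAction ρ) α 1 :=
      fun i j => groupInclusion_mem _
    -- Both sides are of degree one, so the identity can be tested in S_q(V) #_α G.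
    refine sub_eq_zero.1 (eq_zero_of_toSkew_eq_zero_of_mem_range hφ ?_ ?_)
    · refine Submodule.sub_mem _ (Submodule.add_mem _ (Submodule.add_mem _ ?_ ?_) ?_)
        (Submodule.add_mem _ (Submodule.add_mem _ ?_ ?_) ?_)
      · exact mul_vecT_mem_range (hmem _ _) _
      · exact Submodule.smul_mem _ _ (vecT_mul_mem_range (hmem _ _) _)
      · exact Submodule.smul_mem _ _ (mul_vecT_mem_range (hmem _ _) _)
      · exact vecT_mul_mem_range (hmem _ _) _
      · exact Submodule.smul_mem _ _ (mul_vecT_mem_range (hmem _ _) _)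
      · exact Submodule.smul_mem _ _ (vecT_mul_mem_range (hmem _ _) _)
    · simp only [map_sub, map_add, map_smul, map_mul, hκ.toSkew_kappaT, toSkew_vecT]
      exact sub_eq_zero.2 (cocycle_jacobi hμ i j k)

/-- On two vectors μ has degree 1 + 1 - 2 = 0, so its values come from ℂ^α G. Uniqueness holds
because ℂ^α G embeds and a bilinear map is determined on a basis. -/
theorem existsUnique_quantumSkewSymmetrization [Finite G] (hμc : IsConstant μ) :
    ∃! κ : V →ₗ[ℂ] V →ₗ[ℂ] TwistedGroupAlgebra α, IsQuantumSkewSymmetrization κ μ := by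
  have hex : ∀ i j : Fin n, ∃ k : TwistedGroupAlgebra α, groupInclusion φ α k =
      μ (vecS α φ (b i)) (vecS α φ (b j)) - q i j • μ (vecS α φ (b j)) (vecS α φ (b i)) :=
    fun i j => exists_groupInclusion_eq (Submodule.sub_mem _ (hμc.vecS_vecS_mem _ _)
      (Submodule.smul_mem _ _ (hμc.vecS_vecS_mem _ _)))
  choose k hk using hex
  refine ⟨b.constr ℂ fun i => b.constr ℂ fun j => k i j, fun i j => ?_, fun κ' hκ' => ?_⟩
  · rw [Module.Basis.constr_basis, Module.Basis.constr_basis, hk]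
    rfl
  · refine b.ext fun i => b.ext fun j => groupInclusion_injective (φ := φ) ?_
    rw [hκ', Module.Basis.constr_basis, Module.Basis.constr_basis, hk]
    rfl

end Cocycle

/-! ### Words and relations in T(V) #_α G. -/

section WordsInSkew

variable {G : Type*} [Group G] {n : ℕ} {V : Type*} [AddCommGroup V] [Module ℂ V]
  (b : Module.Basis (Fin n) ℂ V) (ρ : Representation ℂ G V) (q : Fin n → Fin n → ℂ)
  (α : NormalizedTwoCocycle G) (κ : V →ₗ[ℂ] V →ₗ[ℂ] TwistedGroupAlgebra α)

/-- The word `w`, as an element of `T(V) #_α G`. -/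
def wordT (w : List (Fin n)) : TwistedSkewGroupAlgebra (tensorAction ρ) α :=
  single _ α 1 (word b w)

theorem wordT_mem {w : List (Fin n)} {m : ℕ} (hw : w.length ≤ m) :
    wordT b ρ α w ∈ skewLE α ρ m :=
  single_word_mem_skewLE 1 hw

theorem wordT_append (u v : List (Fin n)) :
    wordT b ρ α (u ++ v) = wordT b ρ α u * wordT b ρ α v := by
  rw [wordT, wordT, wordT, single_one_mul_single_one, word_append]

theorem wordT_cons (i : Fin n) (v : List (Fin n)) :
    wordT b ρ α (i :: v) = vecT b ρ α i * wordT b ρ α v := by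
  rw [wordT, wordT, vecT, single_one_mul_single_one, word_cons]

theorem wordT_nil : wordT b ρ α [] = 1 := rfl

theorem heckeRel_eq (i j : Fin n) : heckeRel b ρ q κ i j =
    vecT b ρ α i * vecT b ρ α j - q i j • (vecT b ρ α j * vecT b ρ α i) - kappaT b ρ κ i j := by
  rw [heckeRel, quadRel, map_sub, map_smul, vecT, vecT, single_one_mul_single_one,
    single_one_mul_single_one]

theorem wordT_mul_heckeRel_mul (u : List (Fin n)) (i j : Fin n) (v : List (Fin n)) :
    wordT b ρ α u * heckeRel b ρ q κ i j * wordT b ρ α v =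
      wordT b ρ α (u ++ i :: j :: v) - q i j • wordT b ρ α (u ++ j :: i :: v) -
        wordT b ρ α u * kappaT b ρ κ i j * wordT b ρ α v := by
  simp only [heckeRel_eq, wordT_append, wordT_cons, mul_sub, sub_mul, mul_smul_comm,
    smul_mul_assoc, mul_assoc]

variable {ρ α} in
theorem mul_mem_skewLE_of_le {i j k : ℕ} {x y : TwistedSkewGroupAlgebra (tensorAction ρ) α}
    (hx : x ∈ skewLE α ρ i) (hy : y ∈ skewLE α ρ j) (h : i + j ≤ k) : x * y ∈ skewLE α ρ k :=
  skewLE_mono h (mul_mem_skewLE hx hy)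

theorem kappaT_mem (i j : Fin n) : kappaT b ρ κ i j ∈ skewLE α ρ 0 :=
  groupInclusion_mem_skewLE _

/-- Replacing two letters by a value of κ lowers the degree by two, so the correction terms are
known before the word itself is treated. -/
theorem wordT_mul_kappaT_mul_mem (u : List (Fin n)) (i j : Fin n) (v : List (Fin n)) :
    wordT b ρ α u * kappaT b ρ κ i j * wordT b ρ α v ∈ skewLE α ρ (u.length + v.length) :=
  mul_mem_skewLE_of_le (mul_mem_skewLE_of_le (wordT_mem b ρ α le_rfl) (kappaT_mem b ρ α κ i j)
    (add_zero _).le) (wordT_mem b ρ α le_rfl) le_rfl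

end WordsInSkew

/-! ### Construction of Φ by induction on the length of words. -/

section Reduction

variable {G : Type*} [Group G] {n : ℕ} {V : Type*} [AddCommGroup V] [Module ℂ V]
  {b : Module.Basis (Fin n) ℂ V} {ρ : Representation ℂ G V} {q : Fin n → Fin n → ℂ}
  {α : NormalizedTwoCocycle G}
  {φ : G →* (QuantumSymmetricAlgebra b q ≃ₐ[ℂ] QuantumSymmetricAlgebra b q)}
  {κ : V →ₗ[ℂ] V →ₗ[ℂ] TwistedGroupAlgebra α}

variable (ρ) in
/-- The linear map `w t_g ↦ Φ(w) t_g` for words `w`. -/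
def extendWords (Φ : List (Fin n) → TwistedSkewGroupAlgebra φ α) :
    TwistedSkewGroupAlgebra (tensorAction ρ) α →ₗ[ℂ] TwistedSkewGroupAlgebra φ α :=
  (Finsupp.lsum ℂ fun g => LinearMap.mulRight ℂ (single φ α g 1) ∘ₗ
    b.tensorAlgebra.constr ℂ fun w => Φ w.toList) ∘ₗ (toFinsupp _ α).toLinearMap

variable (Φ : List (Fin n) → TwistedSkewGroupAlgebra φ α)

theorem extendWords_single (g : G) (w : List (Fin n)) :
    extendWords ρ Φ (single _ α g (word b w)) = Φ w * single φ α g 1 := by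
  rw [extendWords, LinearMap.comp_apply, LinearEquiv.coe_coe, toFinsupp_single,
    Finsupp.lsum_single, LinearMap.comp_apply, ← tensorAlgebra_basis_apply,
    Module.Basis.constr_basis]
  rfl

theorem extendWords_wordT (w : List (Fin n)) : extendWords ρ Φ (wordT b ρ α w) = Φ w := by
  rw [wordT, extendWords_single]
  exact mul_one _

/-- Moving t_g into w t_h produces the scalar α(h, g) in both algebras. Right linearity over ℂ^α G
reduces statements to bare words. -/
theorem extendWords_mul_single (z : TwistedSkewGroupAlgebra (tensorAction ρ) α) (g : G) :
    extendWords ρ Φ (z * single _ α g 1) = extendWords ρ Φ z * single φ α g 1 := by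
  have h : (⊤ : Submodule ℂ (TwistedSkewGroupAlgebra (tensorAction ρ) α)) ≤ LinearMap.ker
      (extendWords ρ Φ ∘ₗ LinearMap.mulRight ℂ (single _ α g 1) -
        LinearMap.mulRight ℂ (single φ α g 1) ∘ₗ extendWords ρ Φ) := by
    refine top_le_of_single_word_mem b fun h w => ?_
    rw [LinearMap.mem_ker, LinearMap.sub_apply, sub_eq_zero, LinearMap.comp_apply,
      LinearMap.comp_apply, LinearMap.mulRight_apply, LinearMap.mulRight_apply,
      single_mul_single, map_one, mul_one, map_smul, map_smul, extendWords_single,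
      extendWords_single, mul_assoc, single_mul_single, map_one (φ h), mul_one, map_smul,
      mul_smul_comm]
  simpa [sub_eq_zero] using h (x := z) trivial

variable {Φ}

theorem extendWords_congr {Φ' : List (Fin n) → TwistedSkewGroupAlgebra φ α} {m : ℕ}
    (h : ∀ w, w.length ≤ m → Φ w = Φ' w) {x : TwistedSkewGroupAlgebra (tensorAction ρ) α}
    (hx : x ∈ skewLE α ρ m) : extendWords ρ Φ x = extendWords ρ Φ' x := by
  have key : skewLE α ρ m ≤ LinearMap.eqLocus (extendWords ρ Φ) (extendWords ρ Φ') := by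
    refine skewLE_le b fun g w hw => ?_
    rw [LinearMap.mem_eqLocus, extendWords_single, extendWords_single, h w hw]
  exact key hx

variable (α φ) in
/-- The elements of `S_q(V) #_α G` whose components of degree `≥ m` vanish. -/
def degLT (m : ℕ) : Submodule ℂ (TwistedSkewGroupAlgebra φ α) :=
  ⨅ k, ⨅ _ : m ≤ k, LinearMap.ker (skewComponent α φ k)

theorem mem_degLT {m : ℕ} {x : TwistedSkewGroupAlgebra φ α} :
    x ∈ degLT α φ m ↔ ∀ k, m ≤ k → skewComponent α φ k x = 0 := by
  simp [degLT, Submodule.mem_iInf]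

theorem degLT_mono {i j : ℕ} (h : i ≤ j) : degLT α φ i ≤ degLT α φ j :=
  fun _ hx => mem_degLT.2 fun k hk => mem_degLT.1 hx k (h.trans hk)

theorem mul_single_mem_degLT {m : ℕ} {x : TwistedSkewGroupAlgebra φ α} (hx : x ∈ degLT α φ m)
    (g : G) : x * single φ α g 1 ∈ degLT α φ m :=
  mem_degLT.2 fun k hk => by
    rw [skewComponent, mapCoeffs_mul_single, ← skewComponent, mem_degLT.1 hx k hk, zero_mul]

theorem toSkew_mem_degLT (hφ : ExtendsAction ρ b q φ) {m : ℕ}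
    {x : TwistedSkewGroupAlgebra (tensorAction ρ) α} (hx : x ∈ skewLE α ρ m) :
    toSkew α hφ x ∈ degLT α φ (m + 1) :=
  mem_degLT.2 fun k hk => by
    rw [skewComponent_toSkew, tensorSkewComponent_eq_zero b (by omega) hx, map_zero]

variable (κ) in
/-- `Φ` is compatible with the relations of `H_{q,κ,α}` on words of length at most `m`, and
the leading term of `Φ(w)` is the class of `w` in `S_q(V)`. -/
structure IsReduction (hφ : ExtendsAction ρ b q φ) (m : ℕ)
    (Φ : List (Fin n) → TwistedSkewGroupAlgebra φ α) : Prop where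
  rel : ∀ u i j v, (u ++ i :: j :: v).length ≤ m →
    Φ (u ++ i :: j :: v) - q i j • Φ (u ++ j :: i :: v) =
      extendWords ρ Φ (wordT b ρ α u * kappaT b ρ κ i j * wordT b ρ α v)
  lead : ∀ w, w.length ≤ m → Φ w - toSkew α hφ (wordT b ρ α w) ∈ degLT α φ w.length

variable {hφ : ExtendsAction ρ b q φ} {m : ℕ}

theorem IsReduction.congr {Φ' : List (Fin n) → TwistedSkewGroupAlgebra φ α}
    (hΦ : IsReduction κ hφ m Φ) (h : ∀ w, w.length ≤ m → Φ w = Φ' w) :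
    IsReduction κ hφ m Φ' where
  rel u i j v hl := by
    rw [← h _ hl, ← h _ (by simpa using hl), hΦ.rel u i j v hl]
    refine extendWords_congr (m := m) h (skewLE_mono ?_ (wordT_mul_kappaT_mul_mem b ρ α κ u i j v))
    simp at hl
    omega
  lead w hw := h w hw ▸ hΦ.lead w hw

theorem IsReduction.extendWords_sub_mem (hΦ : IsReduction κ hφ m Φ) (g : G) {w : List (Fin n)}
    (hw : w.length ≤ m) : extendWords ρ Φ (single _ α g (word b w)) -
      toSkew α hφ (single _ α g (word b w)) ∈ degLT α φ w.length := by
  have h : toSkew α hφ (single _ α g (word b w)) =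
      toSkew α hφ (wordT b ρ α w) * single φ α g 1 := by
    rw [wordT, toSkew_single, toSkew_single, ← single_eq_mul]
  rw [h, extendWords_single, ← sub_mul]
  exact mul_single_mem_degLT (hΦ.lead w hw) g

theorem IsReduction.extendWords_mem (hΦ : IsReduction κ hφ m Φ) {k : ℕ} (hk : k ≤ m)
    {x : TwistedSkewGroupAlgebra (tensorAction ρ) α} (hx : x ∈ skewLE α ρ k) :
    extendWords ρ Φ x ∈ degLT α φ (k + 1) := by
  have key : skewLE α ρ k ≤ (degLT α φ (k + 1)).comap (extendWords ρ Φ) := by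
    refine skewLE_le b fun g w hw => ?_
    rw [Submodule.mem_comap, ← sub_add_cancel (extendWords ρ Φ _)
      (toSkew α hφ (single _ α g (word b w)))]
    exact Submodule.add_mem _
      (degLT_mono (by omega) (hΦ.extendWords_sub_mem g (hw.trans hk)))
      (toSkew_mem_degLT hφ (single_word_mem_skewLE g hw))
  exact key hx

/-- Write x as u t_g. By equivariance t_g moves across the relation and is absorbed into y, which
keeps its degree bound. Then y is written as v t_h, and t_h splits off by right linearity; what
remains is the defining property of Φ for the words u and v. -/
theorem IsReduction.extendWords_heckeRel (hκ : PBWConditions b ρ q κ)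
    (hΦ : IsReduction κ hφ m Φ) {k l : ℕ} (hkl : k + l + 2 ≤ m)
    {x y : TwistedSkewGroupAlgebra (tensorAction ρ) α} (hx : x ∈ skewLE α ρ k)
    (hy : y ∈ skewLE α ρ l) (i j : Fin n) :
    extendWords ρ Φ (x * heckeRel b ρ q κ i j * y) = 0 := by
  have h1 : ∀ u : List (Fin n), u.length ≤ k → ∀ i j, ∀ y ∈ skewLE α ρ l,
      extendWords ρ Φ (wordT b ρ α u * heckeRel b ρ q κ i j * y) = 0 := by
    intro u hu i j y hy
    have key : skewLE α ρ l ≤ LinearMap.ker (extendWords ρ Φ ∘ₗ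
        LinearMap.mulLeft ℂ (wordT b ρ α u * heckeRel b ρ q κ i j)) := by
      refine skewLE_le b fun g v hv => ?_
      rw [LinearMap.mem_ker, LinearMap.comp_apply, LinearMap.mulLeft_apply, single_eq_mul,
        ← mul_assoc, extendWords_mul_single, ← wordT, wordT_mul_heckeRel_mul, map_sub, map_sub,
        map_smul, extendWords_wordT, extendWords_wordT, hΦ.rel u i j v (by simp; omega), sub_self,
        zero_mul]
    exact key hy
  have h2 : ∀ u : List (Fin n), u.length ≤ k → ∀ e ∈ heckeRels b ρ q κ, ∀ y ∈ skewLE α ρ l,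
      extendWords ρ Φ (wordT b ρ α u * e * y) = 0 := by
    intro u hu e he y hy
    have key : heckeRels b ρ q κ ≤ LinearMap.ker (extendWords ρ Φ ∘ₗ LinearMap.mulRight ℂ y ∘ₗ
        LinearMap.mulLeft ℂ (wordT b ρ α u)) := by
      rw [heckeRels, Submodule.span_le]
      rintro _ ⟨p, rfl⟩
      rw [SetLike.mem_coe, LinearMap.mem_ker, LinearMap.comp_apply, LinearMap.comp_apply,
        LinearMap.mulRight_apply, LinearMap.mulLeft_apply]
      exact h1 u hu p.1 p.2 y hy
    simpa only [LinearMap.mem_ker, LinearMap.comp_apply, LinearMap.mulRight_apply,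
      LinearMap.mulLeft_apply] using key he
  have key : skewLE α ρ k ≤ LinearMap.ker (extendWords ρ Φ ∘ₗ LinearMap.mulRight ℂ y ∘ₗ
      LinearMap.mulRight ℂ (heckeRel b ρ q κ i j)) := by
    refine skewLE_le b fun g u hu => ?_
    obtain ⟨e, he, hge⟩ := hκ.equivariant g i j
    have hgy : single _ α g 1 * y ∈ skewLE α ρ l :=
      mul_mem_skewLE_of_le (single_one_mem_skewLE g) hy (zero_add _).le
    have := h2 u hu e he _ hgy
    rw [LinearMap.mem_ker, LinearMap.comp_apply, LinearMap.comp_apply, LinearMap.mulRight_apply,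
      LinearMap.mulRight_apply, single_eq_mul, ← wordT, mul_assoc (wordT b ρ α u), hge]
    simpa only [mul_assoc] using this
  simpa only [LinearMap.mem_ker, LinearMap.comp_apply, LinearMap.mulRight_apply] using key hx

/-- On words of length m + 1 the new value is the class in S_q(V) plus a correction f of lower
degree. The class has zero skew differences, so f must realise the values of Φ on u κ(v_i, v_j) v,
and `exists_skew_difference_eq` provides it. -/
theorem IsReduction.exists_succ (hq : IsQuantumParameter q) (hκ : PBWConditions b ρ q κ)
    (hΦ : IsReduction κ hφ m Φ) :
    ∃ Φ', IsReduction κ hφ (m + 1) Φ' ∧ ∀ w, w.length ≤ m → Φ' w = Φ w := by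
  have swap : ∀ (x y : TwistedSkewGroupAlgebra (tensorAction ρ) α) (k l : ℕ) (u v : List (Fin n))
      (i j : Fin n), x ∈ skewLE α ρ k → y ∈ skewLE α ρ l →
      k + l + u.length + v.length + 2 ≤ m →
      extendWords ρ Φ (x * wordT b ρ α (u ++ i :: j :: v) * y) -
        q i j • extendWords ρ Φ (x * wordT b ρ α (u ++ j :: i :: v) * y) =
      extendWords ρ Φ (x * (wordT b ρ α u * kappaT b ρ κ i j * wordT b ρ α v) * y) := by
    intro x y k l u v i j hx hy hl
    have h := hΦ.extendWords_heckeRel hκ (k := k + u.length) (l := v.length + l) (by omega)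
      (mul_mem_skewLE hx (wordT_mem b ρ α le_rfl)) (mul_mem_skewLE (wordT_mem b ρ α le_rfl) hy) i j
    have e : x * wordT b ρ α u * heckeRel b ρ q κ i j * (wordT b ρ α v * y) =
        x * (wordT b ρ α u * heckeRel b ρ q κ i j * wordT b ρ α v) * y := by
      simp only [mul_assoc]
    rw [e, wordT_mul_heckeRel_mul, mul_sub, mul_sub, sub_mul, sub_mul, mul_smul_comm,
      smul_mul_assoc, map_sub, map_sub, map_smul] at h
    exact sub_eq_zero.1 h
  obtain ⟨f, hf, hfD⟩ := exists_skew_difference_eq (m := m + 1)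
    (D := fun u i j v => extendWords ρ Φ (wordT b ρ α u * kappaT b ρ κ i j * wordT b ρ α v)) hq
    (fun u i j v => by
      have h : kappaT b ρ κ i j = -(q i j • kappaT b ρ κ j i) := by
        rw [kappaT, hκ.skew, map_neg, map_smul]
        rfl
      rw [h, mul_neg, neg_mul, map_neg, mul_smul_comm, smul_mul_assoc, map_smul])
    -- For disjoint swaps, both differences equal the value at u κ(v_i, v_j) v κ(v_k, v_l) w, by the
    -- relations for shorter words.
    (fun u i j v k l w hl => by
      simp only [List.length_append, List.length_cons] at hl
      have h1 := swap (wordT b ρ α u * kappaT b ρ κ i j) 1 (u.length + 0) 0 v w k l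
        (mul_mem_skewLE (wordT_mem b ρ α le_rfl) (kappaT_mem b ρ α κ i j))
        (single_one_mem_skewLE 1) (by omega)
      have h2 := swap 1 (kappaT b ρ κ k l * wordT b ρ α w) 0 (0 + w.length) u v i j
        (single_one_mem_skewLE 1)
        (mul_mem_skewLE (kappaT_mem b ρ α κ k l) (wordT_mem b ρ α le_rfl)) (by omega)
      simp only [one_mul, mul_one, ← mul_assoc] at h1 h2
      linear_combination (norm := module) h1 - h2)
    -- For overlapping swaps, the Jacobi identity is multiplied by u on the left and w on the right.
    (fun u i j k w hl => by
      have h := congrArg (fun z => extendWords ρ Φ (wordT b ρ α u * z * wordT b ρ α w))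
        (hκ.jacobi i j k)
      simp only [mul_add, add_mul, mul_smul_comm, smul_mul_assoc, map_add, map_smul,
        mul_assoc] at h
      simp only [wordT_append, wordT_cons, wordT_nil, mul_one, mul_assoc]
      exact h)
    (degLT α φ (m + 1))
    (fun u i j v hl => by
      simp only [List.length_append, List.length_cons] at hl
      exact degLT_mono (by omega)
        (hΦ.extendWords_mem (by omega) (wordT_mul_kappaT_mul_mem b ρ α κ u i j v)))
  let Φ' : List (Fin n) → TwistedSkewGroupAlgebra φ α := fun w =>
    if w.length = m + 1 then toSkew α hφ (wordT b ρ α w) + f w else Φ w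
  have hΦ' : ∀ w, w.length ≤ m → Φ w = Φ' w := fun w hw => by
    simp only [Φ']
    rw [if_neg (by omega)]
  have hΦ'' : ∀ w, w.length = m + 1 → Φ' w = toSkew α hφ (wordT b ρ α w) + f w := fun w hw => by
    simp only [Φ']
    rw [if_pos hw]
  refine ⟨Φ', ⟨fun u i j v hl => ?_, fun w hw => ?_⟩, fun w hw => (hΦ' w hw).symm⟩
  · rcases hl.lt_or_eq with hl | hl
    · exact (hΦ.congr hΦ').rel u i j v (by omega)
    · have hs : toSkew α hφ (wordT b ρ α (u ++ i :: j :: v)) =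
          q i j • toSkew α hφ (wordT b ρ α (u ++ j :: i :: v)) := by
        rw [wordT, wordT, toSkew_single, toSkew_single, toSymm_word_swap, map_smul]
      have hm : wordT b ρ α u * kappaT b ρ κ i j * wordT b ρ α v ∈ skewLE α ρ m := by
        refine skewLE_mono ?_ (wordT_mul_kappaT_mul_mem b ρ α κ u i j v)
        simp at hl
        omega
      rw [hΦ'' _ hl, hΦ'' _ (by simpa using hl), hs, smul_add, add_sub_add_left_eq_sub,
        hfD u i j v hl, extendWords_congr hΦ' hm]
  · rcases hw.lt_or_eq with hw | hw
    · exact (hΦ.congr hΦ').lead w (by omega)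
    · rw [hΦ'' w hw, add_sub_cancel_left, hw]
      exact hf w hw

variable (hφ) in
theorem isReduction_zero : IsReduction κ hφ 0 fun w => toSkew α hφ (wordT b ρ α w) where
  rel u i j v hl := by simp at hl
  lead w hw := by
    rw [sub_self]
    exact Submodule.zero_mem _

variable (hφ) in
/-- Under the PBW conditions there is a function on all words that is compatible with the
relations of `H_{q,κ,α}`. -/
theorem exists_isReduction (hq : IsQuantumParameter q) (hκ : PBWConditions b ρ q κ) :
    ∃ Φ : List (Fin n) → TwistedSkewGroupAlgebra φ α, ∀ m, IsReduction κ hφ m Φ := by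
  let next : (m : ℕ) → {Φ // IsReduction κ hφ m Φ} → {Φ // IsReduction κ hφ (m + 1) Φ} :=
    fun m Φ => ⟨(Φ.2.exists_succ hq hκ).choose, (Φ.2.exists_succ hq hκ).choose_spec.1⟩
  let s : (m : ℕ) → {Φ // IsReduction κ hφ m Φ} :=
    fun m => Nat.rec ⟨_, isReduction_zero hφ⟩ next m
  have hs : ∀ m w, w.length ≤ m → (s (m + 1)).1 w = (s m).1 w :=
    fun m => ((s m).2.exists_succ hq hκ).choose_spec.2
  have hs' : ∀ m w, w.length ≤ m → (s m).1 w = (s w.length).1 w := by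
    intro m w hw
    induction m, hw using Nat.le_induction with
    | base => rfl
    | succ m hm ih => rw [hs m w hm, ih]
  -- Later stages do not change the value at w, so the stages glue.
  exact ⟨fun w => (s w.length).1 w, fun m => (s m).2.congr (hs' m)⟩

end Reduction

/-! ### Homogeneous tensors and the graded pieces of S_q(V). -/

section HomogeneousTensors

variable {n : ℕ} {V : Type*} [AddCommGroup V] [Module ℂ V]

theorem range_ι_pow_eq_span (b : Module.Basis (Fin n) ℂ V) (m : ℕ) :
    LinearMap.range (TensorAlgebra.ι ℂ : V →ₗ[ℂ] TensorAlgebra ℂ V) ^ m =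
      Submodule.span ℂ {x | ∃ w : List (Fin n), w.length = m ∧ word b w = x} := by
  induction m with
  | zero =>
    rw [pow_zero, Submodule.one_eq_span]
    congr 1
    ext x
    constructor
    · rintro rfl
      exact ⟨[], rfl, rfl⟩
    · rintro ⟨w, hw, rfl⟩
      rw [List.length_eq_zero_iff.1 hw]
      rfl
  | succ m ih =>
    rw [pow_succ, ih, range_ι_eq_span b, Submodule.span_mul_span]
    congr 1
    ext x
    constructor
    · rintro ⟨_, ⟨w, hw, rfl⟩, _, ⟨w', hw', rfl⟩, rfl⟩
      exact ⟨w ++ w', by simp; omega, word_append b w w'⟩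
    · rintro ⟨w, hw, rfl⟩
      refine ⟨word b (w.take m), ⟨_, by simp; omega, rfl⟩, word b (w.drop m),
        ⟨_, by simp; omega, rfl⟩, ?_⟩
      change word b _ * word b _ = _
      rw [← word_append, List.take_append_drop]

theorem tensorComponent_mem_pow (b : Module.Basis (Fin n) ℂ V) (m : ℕ) (x : TensorAlgebra ℂ V) :
    tensorComponent V m x ∈
      LinearMap.range (TensorAlgebra.ι ℂ : V →ₗ[ℂ] TensorAlgebra ℂ V) ^ m := by
  have h : (⊤ : Submodule ℂ (TensorAlgebra ℂ V)) ≤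
      (LinearMap.range (TensorAlgebra.ι ℂ : V →ₗ[ℂ] TensorAlgebra ℂ V) ^ m).comap
        (tensorComponent V m) := by
    rw [← span_word b, Submodule.span_le]
    rintro _ ⟨w, rfl⟩
    rw [SetLike.mem_coe, Submodule.mem_comap, tensorComponent_word, range_ι_pow_eq_span b]
    split_ifs with hw
    · exact Submodule.subset_span ⟨w, hw, rfl⟩
    · exact Submodule.zero_mem _
  exact h trivial

theorem range_ι_pow_le_tensorLE (m : ℕ) :
    LinearMap.range (TensorAlgebra.ι ℂ : V →ₗ[ℂ] TensorAlgebra ℂ V) ^ m ≤ tensorLE V m :=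
  pow_le_pow_left' le_sup_right m

theorem tensorComponent_of_mem_pow (b : Module.Basis (Fin n) ℂ V) {m : ℕ} {x : TensorAlgebra ℂ V}
    (hx : x ∈ LinearMap.range (TensorAlgebra.ι ℂ : V →ₗ[ℂ] TensorAlgebra ℂ V) ^ m) (k : ℕ) :
    tensorComponent V k x = if m = k then x else 0 := by
  rw [range_ι_pow_eq_span b] at hx
  induction hx using Submodule.span_induction with
  | mem x hx =>
    obtain ⟨w, rfl, rfl⟩ := hx
    exact tensorComponent_word b k w
  | zero => simp
  | add x y _ _ hx hy =>
    rw [map_add, hx, hy]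
    split_ifs <;> simp
  | smul c x _ hx =>
    rw [map_smul, hx]
    split_ifs <;> simp

theorem piece_eq_map (b : Module.Basis (Fin n) ℂ V) (q : Fin n → Fin n → ℂ) (m : ℕ) :
    CommutationAlgebra.piece b q m =
      (LinearMap.range (TensorAlgebra.ι ℂ : V →ₗ[ℂ] TensorAlgebra ℂ V) ^ m).map
        (toSymm b q).toLinearMap := by
  rw [Submodule.map_pow, ← LinearMap.range_comp]
  rfl

end HomogeneousTensors

/-! ### The associated graded algebra of H_{q,κ,α}. -/

section AssociatedGraded

variable {G : Type*} [Group G] {n : ℕ} {V : Type*} [AddCommGroup V] [Module ℂ V]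
  {b : Module.Basis (Fin n) ℂ V} {ρ : Representation ℂ G V} {q : Fin n → Fin n → ℂ}
  {α : NormalizedTwoCocycle G}
  {φ : G →* (QuantumSymmetricAlgebra b q ≃ₐ[ℂ] QuantumSymmetricAlgebra b q)}
  {κ : V →ₗ[ℂ] V →ₗ[ℂ] TwistedGroupAlgebra α}
  {hφ : ExtendsAction ρ b q φ} {Φ : List (Fin n) → TwistedSkewGroupAlgebra φ α}

theorem mk_surjective : Function.Surjective (HeckeAlgebra.mk ρ b q α κ) :=
  RingQuot.mkAlgHom_surjective ℂ _

theorem mk_mem_F {m : ℕ} {x : TwistedSkewGroupAlgebra (tensorAction ρ) α}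
    (hx : x ∈ skewLE α ρ m) :
    HeckeAlgebra.mk ρ b q α κ x ∈ (HeckeAlgebra.filtration ρ b q α κ).F m :=
  ⟨x, hx, rfl⟩

theorem mk_mem_prev_of_lt {k m : ℕ} (hkm : k < m)
    {x : TwistedSkewGroupAlgebra (tensorAction ρ) α} (hx : x ∈ skewLE α ρ k) :
    HeckeAlgebra.mk ρ b q α κ x ∈ (HeckeAlgebra.filtration ρ b q α κ).prev m := by
  cases m with
  | zero => omega
  | succ m => exact mk_mem_F (skewLE_mono (Nat.le_of_lt_succ hkm) hx)

theorem mk_heckeRel (i j : Fin n) : HeckeAlgebra.mk ρ b q α κ (single _ α 1 (quadRel b q i j)) =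
    HeckeAlgebra.mk ρ b q α κ (kappaT b ρ κ i j) :=
  RingQuot.mkAlgHom_rel ℂ (HeckeRel.mk i j)

/-- The elements z for which c z d is killed for all c and d form a two-sided ideal. It contains the
relations by `IsReduction.extendWords_heckeRel`, applied with m large enough for the degrees of c
and d. -/
theorem extendWords_eq_of_mk_eq (hκ : PBWConditions b ρ q κ)
    (hΦ : ∀ m, IsReduction κ hφ m Φ) {x y : TwistedSkewGroupAlgebra (tensorAction ρ) α}
    (h : HeckeAlgebra.mk ρ b q α κ x = HeckeAlgebra.mk ρ b q α κ y) :
    extendWords ρ Φ x = extendWords ρ Φ y := by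
  let N : Submodule ℂ (TwistedSkewGroupAlgebra (tensorAction ρ) α) :=
    ⨅ c, ⨅ d, LinearMap.ker (extendWords ρ Φ ∘ₗ LinearMap.mulRight ℂ d ∘ₗ LinearMap.mulLeft ℂ c)
  have hN : ∀ z, z ∈ N ↔ ∀ c d, extendWords ρ Φ (c * z * d) = 0 := fun z => by
    simp only [N, Submodule.mem_iInf, LinearMap.mem_ker, LinearMap.comp_apply,
      LinearMap.mulRight_apply, LinearMap.mulLeft_apply]
  have hxy : x - y ∈ N := by
    refine sub_mem_of_mkAlgHom_eq N (fun x y hy => ?_) (fun x y hx => ?_) ?_ h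
    · rw [hN] at hy ⊢
      intro c d
      rw [← mul_assoc]
      exact hy (c * x) d
    · rw [hN] at hx ⊢
      intro c d
      rw [← mul_assoc c, mul_assoc]
      exact hx c (y * d)
    · rintro _ _ ⟨i, j⟩
      rw [hN]
      intro c d
      obtain ⟨k, hk⟩ := exists_mem_skewLE b c
      obtain ⟨l, hl⟩ := exists_mem_skewLE b d
      exact (hΦ (k + l + 2)).extendWords_heckeRel hκ le_rfl hk hl i j
  have h1 := (hN _).1 hxy 1 1
  rwa [one_mul, mul_one, map_sub, sub_eq_zero] at h1

/-- A reduction induces a linear map on `H_{q,κ,α}`. -/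
theorem exists_linearMap_heckeAlgebra (hκ : PBWConditions b ρ q κ)
    (hΦ : ∀ m, IsReduction κ hφ m Φ) :
    ∃ F : HeckeAlgebra ρ b q α κ →ₗ[ℂ] TwistedSkewGroupAlgebra φ α,
      ∀ x, F (HeckeAlgebra.mk ρ b q α κ x) = extendWords ρ Φ x := by
  let p := (HeckeAlgebra.mk ρ b q α κ).toLinearMap
  have hp : LinearMap.ker p ≤ LinearMap.ker (extendWords ρ Φ) := fun x hx => by
    rw [LinearMap.mem_ker, ← map_zero (extendWords ρ Φ)]
    exact extendWords_eq_of_mk_eq hκ hΦ (hx.trans (map_zero _).symm)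
  refine ⟨(LinearMap.ker p).liftQ (extendWords ρ Φ) hp ∘ₗ
    (p.quotKerEquivOfSurjective mk_surjective).symm.toLinearMap, fun x => ?_⟩
  have h : (p.quotKerEquivOfSurjective mk_surjective).symm (p x) = Submodule.Quotient.mk x := by
    rw [LinearEquiv.symm_apply_eq]
    rfl
  change (LinearMap.ker p).liftQ (extendWords ρ Φ) hp
    ((p.quotKerEquivOfSurjective mk_surjective).symm (p x)) = _
  rw [h]
  rfl

theorem skewComponent_extendWords (hΦ : ∀ m, IsReduction κ hφ m Φ) {m : ℕ}
    {x : TwistedSkewGroupAlgebra (tensorAction ρ) α} (hx : x ∈ skewLE α ρ m) :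
    skewComponent α φ m (extendWords ρ Φ x) = skewComponent α φ m (toSkew α hφ x) := by
  have key : skewLE α ρ m ≤
      (LinearMap.ker (skewComponent α φ m)).comap (extendWords ρ Φ - (toSkew α hφ).toLinearMap) :=
    skewLE_le b fun g w hw =>
      mem_degLT.1 ((hΦ m).extendWords_sub_mem g hw) m hw
  have := key hx
  rwa [Submodule.mem_comap, LinearMap.mem_ker, LinearMap.sub_apply, map_sub, sub_eq_zero] at this

/-- The kernel of `T(V) → S_q(V)` maps to elements of lower degree in `H_{q,κ,α}`. -/
theorem mk_tensorComponent_mem_prev {z : TensorAlgebra ℂ V} (hz : toSymm b q z = 0) (k : ℕ) :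
    HeckeAlgebra.mk ρ b q α κ (single _ α 1 (tensorComponent V k z)) ∈
      (HeckeAlgebra.filtration ρ b q α κ).prev k := by
  let p : ℕ → TensorAlgebra ℂ V →ₗ[ℂ] HeckeAlgebra ρ b q α κ := fun k =>
    (HeckeAlgebra.mk ρ b q α κ).toLinearMap ∘ₗ single _ α 1 ∘ₗ tensorComponent V k
  have hp : ∀ k z, p k z = HeckeAlgebra.mk ρ b q α κ (single _ α 1 (tensorComponent V k z)) :=
    fun _ _ => rfl
  have hF : ∀ k z, p k z ∈ (HeckeAlgebra.filtration ρ b q α κ).F k := fun k z =>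
    mk_mem_F (single_mem_coeffsIn _ (range_ι_pow_le_tensorLE k (tensorComponent_mem_pow b k z)))
  have hmul : ∀ k x y, p k (x * y) = ∑ i ∈ Finset.HasAntidiagonal.antidiagonal k,
      p i.1 x * p i.2 y := fun k x y => by
    simp only [hp, tensorComponent_mul, map_sum, ← single_one_mul_single_one, map_mul]
  -- An ideal, because components of a product are sums of products of components. A quadratic
  -- relation lies in it: its only component, of degree two, becomes κ(v_i, v_j) of degree zero.
  let N : Submodule ℂ (TensorAlgebra ℂ V) :=
    ⨅ k, ((HeckeAlgebra.filtration ρ b q α κ).prev k).comap (p k)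
  have hN : ∀ z, z ∈ N ↔ ∀ k, p k z ∈ (HeckeAlgebra.filtration ρ b q α κ).prev k := fun z => by
    simp only [N, Submodule.mem_iInf, Submodule.mem_comap]
  have h : z - 0 ∈ N := by
    refine sub_mem_of_mkAlgHom_eq (r := CommutationRel b q) N ?_ ?_ ?_
      (hz.trans (map_zero (toSymm b q)).symm)
    · intro x y hy
      rw [hN] at hy ⊢
      intro k
      rw [hmul]
      refine Submodule.sum_mem _ fun i hi => ?_
      rw [← Finset.HasAntidiagonal.mem_antidiagonal.1 hi]
      exact AlgebraFiltration.mul_prev_mem _ (hF _ _) (hy _)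
    · intro x y hx
      rw [hN] at hx ⊢
      intro k
      rw [hmul]
      refine Submodule.sum_mem _ fun i hi => ?_
      rw [← Finset.HasAntidiagonal.mem_antidiagonal.1 hi]
      exact AlgebraFiltration.prev_mul_mem _ (hx _) (hF _ _)
    · rintro _ _ ⟨i, j⟩
      change quadRel b q i j ∈ N
      rw [hN]
      intro k
      rw [hp, tensorComponent_quadRel]
      split_ifs with hk
      · rw [hk, mk_heckeRel]
        exact mk_mem_prev_of_lt (Nat.succ_pos 1) (kappaT_mem b ρ α κ i j)
      · rw [map_zero, map_zero]
        exact Submodule.zero_mem _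
  rw [sub_zero, hN] at h
  exact h k

/-- This gives injectivity on F_m / F_{m-1}, for every κ. The parts of x of degree below m lie in
F_{m-1} anyway. The part of degree m has coefficients in the kernel of T(V) → S_q(V), which
`mk_tensorComponent_mem_prev` sends to F_{m-1}. -/
theorem mk_mem_prev {m : ℕ} {x : TwistedSkewGroupAlgebra (tensorAction ρ) α}
    (hx : x ∈ skewLE α ρ m) (h : skewComponent α φ m (toSkew α hφ x) = 0) :
    HeckeAlgebra.mk ρ b q α κ x ∈ (HeckeAlgebra.filtration ρ b q α κ).prev m := by
  let P := (HeckeAlgebra.filtration ρ b q α κ).prev m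
  have h1 : HeckeAlgebra.mk ρ b q α κ (x - tensorSkewComponent α ρ m x) ∈ P := by
    have key : skewLE α ρ m ≤ P.comap ((HeckeAlgebra.mk ρ b q α κ).toLinearMap ∘ₗ
        (LinearMap.id - tensorSkewComponent α ρ m)) := by
      refine skewLE_le b fun g w hw => ?_
      change HeckeAlgebra.mk ρ b q α κ (single _ α g (word b w) -
        tensorSkewComponent α ρ m (single _ α g (word b w))) ∈ P
      rw [tensorSkewComponent, mapCoeffs_single, tensorComponent_word]
      split_ifs with hwm
      · rw [sub_self, map_zero]
        exact P.zero_mem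
      · rw [map_zero, sub_zero]
        exact mk_mem_prev_of_lt (lt_of_le_of_ne hw hwm) (single_word_mem_skewLE g le_rfl)
    exact key hx
  have h2 : HeckeAlgebra.mk ρ b q α κ (tensorSkewComponent α ρ m x) ∈ P := by
    let W : Submodule ℂ (TensorAlgebra ℂ V) := LinearMap.ker (toSymm b q).toLinearMap ⊓
      LinearMap.range (TensorAlgebra.ι ℂ : V →ₗ[ℂ] TensorAlgebra ℂ V) ^ m
    have key : coeffsIn (tensorAction ρ) α W ≤
        P.comap (HeckeAlgebra.mk ρ b q α κ).toLinearMap := by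
      refine coeffsIn_le fun g z hz => ?_
      have hz1 := mk_tensorComponent_mem_prev (ρ := ρ) (α := α) (κ := κ) hz.1 m
      rw [tensorComponent_of_mem_pow b hz.2, if_pos rfl] at hz1
      change HeckeAlgebra.mk ρ b q α κ (single _ α g z) ∈ P
      rw [single_eq_mul, map_mul]
      exact AlgebraFiltration.prev_mul_mem (j := 0) _ hz1 (mk_mem_F (single_one_mem_skewLE g))
    refine key (mem_coeffsIn.2 fun g => ⟨?_, tensorComponent_mem_pow b m _⟩)
    rw [skewComponent_toSkew] at h
    exact congrArg (coeff φ α g) h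
  have h3 := P.add_mem h1 h2
  rwa [← map_add, sub_add_cancel] at h3

theorem skewComponent_skewComponent [Finite G] (hφ : ExtendsAction ρ b q φ) (k m : ℕ)
    (x : TwistedSkewGroupAlgebra φ α) :
    skewComponent α φ k (skewComponent α φ m x) = if m = k then skewComponent α φ m x else 0 := by
  obtain ⟨y, rfl⟩ := toSkew_surjective hφ x
  rw [skewComponent_toSkew, skewComponent_toSkew]
  have h : tensorSkewComponent α ρ k (tensorSkewComponent α ρ m y) =
      if m = k then tensorSkewComponent α ρ m y else 0 := by
    refine ext_coeff fun g => ?_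
    have := tensorComponent_of_mem_pow b
      (tensorComponent_mem_pow b m (coeff (tensorAction ρ) α g y)) k
    rw [tensorSkewComponent, coeff_mapCoeffs, tensorSkewComponent, coeff_mapCoeffs, this]
    split_ifs
    · rfl
    · rw [map_zero]
  rw [h]
  split_ifs
  · rfl
  · rw [map_zero]

/-- The leading component of an element of `H_{q,κ,α}` of degree at most `m`, as a linear map
`F_m / F_{m-1} → S_q(V) #_α G`. -/
theorem exists_grPiece_linearMap (hq : IsQuantumParameter q) (hφ : ExtendsAction ρ b q φ)
    (hκ : PBWConditions b ρ q κ) (m : ℕ) :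
    ∃ ε : (HeckeAlgebra.filtration ρ b q α κ).GrPiece m →ₗ[ℂ] TwistedSkewGroupAlgebra φ α,
      ∀ (x : TwistedSkewGroupAlgebra (tensorAction ρ) α) (hx : x ∈ skewLE α ρ m),
        ε ((HeckeAlgebra.filtration ρ b q α κ).toGr m ⟨_, mk_mem_F hx⟩) =
          skewComponent α φ m (toSkew α hφ x) := by
  obtain ⟨Φ, hΦ⟩ := exists_isReduction hφ hq hκ
  obtain ⟨F, hF⟩ := exists_linearMap_heckeAlgebra hκ hΦ
  let ℱ := HeckeAlgebra.filtration ρ b q α κ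
  refine ⟨((ℱ.prev m).submoduleOf (ℱ.F m)).liftQ
    (skewComponent α φ m ∘ₗ F ∘ₗ (ℱ.F m).subtype) ?_, fun x hx => ?_⟩
  -- The leading component is well defined on the quotient: Φ does not raise degrees, so the image
  -- of F_{m-1} has no component of degree m.
  · rintro ⟨y, hy⟩ hy'
    have hy' : y ∈ ℱ.prev m := hy'
    change skewComponent α φ m (F y) = 0
    cases m with
    | zero =>
      rw [(Submodule.mem_bot ℂ).1 hy', map_zero, map_zero]
    | succ m =>
      obtain ⟨x, hx, rfl⟩ := hy'
      have hx : x ∈ skewLE α ρ m := hx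
      change skewComponent α φ (m + 1) (F (HeckeAlgebra.mk ρ b q α κ x)) = 0
      rw [hF]
      exact mem_degLT.1 ((hΦ m).extendWords_mem le_rfl hx) _ le_rfl
  · change skewComponent α φ m (F (HeckeAlgebra.mk ρ b q α κ x)) = _
    rw [hF, skewComponent_extendWords hΦ hx]

/-- The Poincaré–Birkhoff–Witt theorem for `H_{q,κ,α}`: under the PBW conditions the associated
graded algebra is `S_q(V) #_α G`. -/
theorem exists_gr_algEquiv [Finite G] (hq : IsQuantumParameter q) (hφ : ExtendsAction ρ b q φ)
    (hκ : PBWConditions b ρ q κ) :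
    ∃ e : (HeckeAlgebra.filtration ρ b q α κ).Gr ≃ₐ[ℂ] TwistedSkewGroupAlgebra φ α,
      ∀ m : ℕ, ((HeckeAlgebra.filtration ρ b q α κ).grComponent m).map e.toLinearMap =
        coeffsIn φ α (CommutationAlgebra.piece b q m) := by
  let ℱ := HeckeAlgebra.filtration ρ b q α κ
  choose ε hε using fun m => exists_grPiece_linearMap hq hφ hκ m
  have hlift : ∀ m (z : ℱ.GrPiece m), ∃ (x : TwistedSkewGroupAlgebra (tensorAction ρ) α)
      (hx : x ∈ skewLE α ρ m), ℱ.toGr m ⟨_, mk_mem_F hx⟩ = z := by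
    intro m z
    obtain ⟨⟨_, x, hx, rfl⟩, rfl⟩ := ℱ.toGr_surjective m z
    exact ⟨x, hx, rfl⟩
  let f : ℱ.Gr →ₐ[ℂ] TwistedSkewGroupAlgebra φ α := DirectSum.toAlgebra ℂ ℱ.GrPiece ε
    (by
      have h1 : (1 : TwistedSkewGroupAlgebra (tensorAction ρ) α) ∈ skewLE α ρ 0 :=
        single_one_mem_skewLE 1
      have h := hε 0 1 h1
      have e1 : (GradedMonoid.GOne.one : ℱ.GrPiece 0) = ℱ.toGr 0 ⟨_, mk_mem_F h1⟩ :=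
        congrArg (ℱ.toGr 0) (Subtype.ext (map_one (HeckeAlgebra.mk ρ b q α κ)).symm)
      rw [e1, h, skewComponent_toSkew, tensorSkewComponent, one_def, mapCoeffs_single,
        tensorComponent_one, if_pos rfl, ← one_def, map_one])
    (by
      intro i j x y
      obtain ⟨x, hx, rfl⟩ := hlift i x
      obtain ⟨y, hy, rfl⟩ := hlift j y
      have e1 : (GradedMonoid.GMul.mul (ℱ.toGr i ⟨_, mk_mem_F hx⟩)
          (ℱ.toGr j ⟨_, mk_mem_F hy⟩) : ℱ.GrPiece (i + j)) =
            ℱ.toGr (i + j) ⟨_, mk_mem_F (mul_mem_skewLE hx hy)⟩ :=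
        congrArg (ℱ.toGr (i + j)) (Subtype.ext (map_mul (HeckeAlgebra.mk ρ b q α κ) x y).symm)
      rw [e1, hε _ _ (mul_mem_skewLE hx hy), hε _ _ hx, hε _ _ hy, skewComponent_toSkew,
        tensorSkewComponent_mul b hx hy, map_mul,
        skewComponent_toSkew, skewComponent_toSkew])
  have hf : ∀ m z, f (DirectSum.lof ℂ ℕ ℱ.GrPiece m z) = ε m z := fun m z =>
    DirectSum.toAddMonoid_of (fun i => (ε i).toAddMonoidHom) m z
  have hker : ∀ m (z : ℱ.GrPiece m), ε m z = 0 → z = 0 := by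
    intro m z hz
    obtain ⟨x, hx, rfl⟩ := hlift m z
    rw [hε _ _ hx] at hz
    exact ℱ.toGr_eq_zero _ (mk_mem_prev hx hz)
  -- Each ε m takes values in degree m, so the components of f y recover the images of the
  -- components of y, and injectivity reduces to single pieces.
  have hcomp : ∀ k (y : ℱ.Gr), skewComponent α φ k (f y) = ε k (y k) := by
    intro k y
    have h : skewComponent α φ k ∘ₗ f.toLinearMap = ε k ∘ₗ DirectSum.component ℂ ℕ ℱ.GrPiece k := by
      refine DirectSum.linearMap_ext ℂ fun m => LinearMap.ext fun z => ?_
      change skewComponent α φ k (f (DirectSum.lof ℂ ℕ ℱ.GrPiece m z)) =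
        ε k (DirectSum.component ℂ ℕ ℱ.GrPiece k (DirectSum.lof ℂ ℕ ℱ.GrPiece m z))
      obtain ⟨x, hx, rfl⟩ := hlift m z
      rw [hf, hε _ _ hx, skewComponent_skewComponent hφ]
      split_ifs with hmk
      · subst hmk
        rw [DirectSum.component.lof_self, hε _ _ hx]
      · rw [DirectSum.component.of, dif_neg hmk, map_zero]
    exact LinearMap.congr_fun h y
  have hinj : Function.Injective f := by
    refine (injective_iff_map_eq_zero f).2 fun y hy => DFinsupp.ext fun k => hker k _ ?_
    rw [← hcomp, hy, map_zero]
  have hrange : ∀ m, LinearMap.range (ε m) = coeffsIn φ α (CommutationAlgebra.piece b q m) := by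
    intro m
    refine le_antisymm ?_ (coeffsIn_le fun g z hz => ?_)
    · rintro _ ⟨z, rfl⟩
      obtain ⟨x, hx, rfl⟩ := hlift m z
      rw [hε _ _ hx, skewComponent_toSkew]
      refine mem_coeffsIn.2 fun g => ?_
      rw [piece_eq_map]
      exact ⟨_, tensorComponent_mem_pow b m (coeff _ α g x), rfl⟩
    · rw [piece_eq_map] at hz
      obtain ⟨z, hz, rfl⟩ := hz
      have hm : single _ α g z ∈ skewLE α ρ m :=
        single_mem_coeffsIn g (range_ι_pow_le_tensorLE m hz)
      refine ⟨ℱ.toGr m ⟨_, mk_mem_F hm⟩, ?_⟩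
      rw [hε _ _ hm, skewComponent_toSkew, tensorSkewComponent, mapCoeffs_single,
        tensorComponent_of_mem_pow b hz, if_pos rfl, toSkew_single]
      rfl
  have hsurj : Function.Surjective f := by
    intro y
    obtain ⟨x, rfl⟩ := toSkew_surjective hφ y
    have key : (⊤ : Submodule ℂ (TwistedSkewGroupAlgebra (tensorAction ρ) α)) ≤
        (LinearMap.range f.toLinearMap).comap (toSkew α hφ).toLinearMap := by
      -- The class of w t_g in filtration degree `w.length` is a preimage of its image in S_q(V) #_α
      -- G.
      refine top_le_of_single_word_mem b fun g w => ?_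
      have hw : single _ α g (word b w) ∈ skewLE α ρ w.length := single_word_mem_skewLE g le_rfl
      refine ⟨DirectSum.lof ℂ ℕ ℱ.GrPiece w.length
        (ℱ.toGr w.length ⟨_, mk_mem_F hw⟩), ?_⟩
      refine (hf _ _).trans ?_
      rw [hε _ _ hw, skewComponent_toSkew, tensorSkewComponent,
        mapCoeffs_single, tensorComponent_word, if_pos rfl]
      rfl
    exact key (x := x) trivial
  refine ⟨AlgEquiv.ofBijective f ⟨hinj, hsurj⟩, fun m => ?_⟩
  rw [← hrange m, AlgebraFiltration.grComponent, ← LinearMap.range_comp]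
  congr 1
  exact LinearMap.ext fun z => hf m z

end AssociatedGraded

end QDHA

end

theorem mainTheorem5 {G : Type*} [Group G] [Finite G] {n : ℕ}
    {V : Type*} [AddCommGroup V] [Module ℂ V] (b : Module.Basis (Fin n) ℂ V)
    (ρ : Representation ℂ G V)
    (q : Fin n → Fin n → ℂ) (hq : QDHA.IsQuantumParameter q)
    (α : QDHA.NormalizedTwoCocycle G)
    (φ : G →* (QDHA.QuantumSymmetricAlgebra b q ≃ₐ[ℂ] QDHA.QuantumSymmetricAlgebra b q))
    (hφ : QDHA.ExtendsAction ρ b q φ)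
    (hΛ : ∃ ψ : G →* (QDHA.QuantumExteriorAlgebra b q ≃ₐ[ℂ] QDHA.QuantumExteriorAlgebra b q),
      QDHA.ExtendsAction ρ b (fun i j => -q i j) ψ)
    (μ : QDHA.TwistedSkewGroupAlgebra φ α →ₗ[ℂ] QDHA.TwistedSkewGroupAlgebra φ α →ₗ[ℂ]
      QDHA.TwistedSkewGroupAlgebra φ α)
    (hμ : QDHA.IsHochschildTwoCocycle μ) (hμc : QDHA.IsConstant μ) :
    (∃! κ : V →ₗ[ℂ] V →ₗ[ℂ] QDHA.TwistedGroupAlgebra α,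
      QDHA.IsQuantumSkewSymmetrization κ μ) ∧
    ∀ κ : V →ₗ[ℂ] V →ₗ[ℂ] QDHA.TwistedGroupAlgebra α,
      QDHA.IsQuantumSkewSymmetrization κ μ →
        QDHA.IsTwistedQuantumDrinfeldHecke ρ b q α κ φ :=
  ⟨QDHA.existsUnique_quantumSkewSymmetrization hμc, fun _ hκ =>
    ⟨hκ.skew hq, QDHA.exists_gr_algEquiv hq hφ (hκ.pbwConditions hq hφ hμ hμc)⟩⟩
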